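/- Call a set $C\subset\mathbb C$ an analytic Jordan arc if $C=\gamma([0,1])$ for some $\gamma$ that is real-analytic on a neighbourhood of $[0,1]$, injective on $[0,1]$ and satisfies $\gamma'(t)\neq0$ for all $t\in[0,1]$; the endpoints of $C$ are $\gamma(0)$ and $\gamma(1)$. Say that a set consists of $k$ analytic Jordan arcs if it is the union of $k$ analytic Jordan arcs, any two of which meet in at most finitely many points. Let $T_n$ be a complex polynomial of degree $n\ge1$, and let $S=T_n^{-1}([-1,1])=\{z\in\mathbb C: T_n(z)\in[-1,1]\}$. (i) For every integer $\nu\ge0$ and all $b_1,\dots,b_{2\nu}\in\mathbb C$ (not necessarily distinct), the following are equivalent: (a) $S$ consists of $\nu$ analytic Jordan arcs such that the list of the $2\nu$ endpoints of these arcs (each point listed as often as it is an endpoint of one of the arcs) is, up to order, $b_1,\dots,b_{2\nu}$, and $S$ does not consist of fewer than $\nu$ analytic Jordan arcs; (b) the zeros of odd multiplicity of $T_n^2-1$, written according to their multiplicity, are exactly $b_1,\dots,b_{2\nu}$, up to order. (ii) If $S$ is the union of $k$ analytic Jordan arcs, which may overlap, then the number of zeros of odd multiplicity of $T_n^2-1$,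 counted with multiplicity, is at most $2k$. (iii) Arcs can be merged only at zeros of even multiplicity: if $C,C'\subseteq S$ are analytic Jordan arcs whose endpoints are zeros of $T_n^2-1$, if $C\cap C'$ is finite, and if $C\cup C'$ is an analytic Jordan arc, then $C\cap C'=\{z_0\}$, where $z_0$ is a common endpoint of $C$ and $C'$ and a zero of $T_n^2-1$ of even multiplicity. -/

import Mathlib

/-- `γ`, restricted to `[0,1]`, is a regular real-analytic injective parametrisation (analytic on a
neighbourhood of `[0,1]`, with nonvanishing derivative); the endpoints are `γ 0` and `γ 1`. -/
structure IsAnalyticArcParam (γ : ℝ → ℂ) : Prop where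
  analytic : AnalyticOnNhd ℝ γ (Set.Icc 0 1)
  injective : Set.InjOn γ (Set.Icc 0 1)
  regular : ∀ t ∈ Set.Icc (0 : ℝ) 1, deriv γ t ≠ 0

/-- The set of points traced by a parametrised arc. -/
def arcTrace (γ : ℝ → ℂ) : Set ℂ := γ '' Set.Icc 0 1

/-- A set is an analytic Jordan arc if it has an analytic parametrisation as above. -/
def IsAnalyticJordanArc (C : Set ℂ) : Prop :=
  ∃ γ : ℝ → ℂ, IsAnalyticArcParam γ ∧ arcTrace γ = C

/-- The `k` analytic Jordan arcs `γ i` have union `S` (they may overlap arbitrarily). -/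
structure IsArcCover (S : Set ℂ) {k : ℕ} (γ : Fin k → ℝ → ℂ) : Prop where
  arc : ∀ i, IsAnalyticArcParam (γ i)
  union : ⋃ i, arcTrace (γ i) = S

/-- `S` consists of the `k` analytic Jordan arcs `γ i`: it is their union, and any two of them meet
in at most finitely many points (they may cross or touch, but do not overlap). -/
structure IsArcDecomposition (S : Set ℂ) {k : ℕ} (γ : Fin k → ℝ → ℂ) : Prop
    extends IsArcCover S γ where
  finite_inter : ∀ i j, i ≠ j → (arcTrace (γ i) ∩ arcTrace (γ j)).Finite

/-- The `2k` endpoints of `k` arcs: a point is listed as often as it is an endpoint of an arc. -/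
def arcEndpoints {k : ℕ} (γ : Fin k → ℝ → ℂ) : Multiset ℂ :=
  Finset.univ.val.map (fun i => γ i 0) + Finset.univ.val.map (fun i => γ i 1)

/-- The inverse image of the real interval `[-1,1]` under a complex polynomial. -/
def inverseImage (T : Polynomial ℂ) : Set ℂ :=
  {z | ∃ x ∈ Set.Icc (-1 : ℝ) 1, T.eval z = (x : ℂ)}

/-- The zeros of odd multiplicity of a polynomial, listed according to their multiplicity. -/
noncomputable def oddZeros (Q : Polynomial ℂ) : Multiset ℂ :=
  Q.roots.filter (fun z => Odd (Q.rootMultiplicity z))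

/-!
Near a point `z₀` of `inverseImage T` at which `T` has local degree `m`, a local coordinate `w`
turns `T` into `T z₀ + w ^ m`, so the set is a star of straight rays: `2 m` rays with equal angles
if `T z₀` lies inside `(-1, 1)`, and `m` rays if `z₀` is a zero of `T ^ 2 - 1`, where `m` is then
the multiplicity of the zero. An arc passing through `z₀` covers two opposite rays, whereas for odd
`m` no two of the `m` rays are opposite; so in every cover by arcs each of these rays is the germ of
an end of an arc, and at least `m` of the arcs' ends lie at `z₀`.

Conversely, cover `inverseImage T` by the least number of arcs. No two of them have parallel
tangents at a common point: a unit-speed curve on which `T` is real is determined by its initial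
point and direction, so the two arcs would be pieces of one analytic curve `γ` on which `T` is real,
and would merge into a single arc. That `γ` has no loops follows from the density of the polynomials
in the continuous functions on a compact set on which `T` is real, obtained by interpolating on the
finite fibres of `T` and gluing with continuous functions of `T`: since polynomials have primitives,
a loop would satisfy `∫ h (γ t) γ' t = 0` for every continuous `h`. Now if an arc ends at a point,
the ray opposite to that end is not in the set, as an arc covering it would have a parallel tangent;
so the point is a zero of odd multiplicity `m`, and each of its `m` rays is the germ of at most
one end.
-/

open Filter Topology Set

section Analysis

theorem exists_analyticAt_localInverse {𝕜 : Type*} [RCLike 𝕜] {f : 𝕜 → 𝕜} {a : 𝕜}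
    (hf : AnalyticAt 𝕜 f a) (ha : deriv f a ≠ 0) :
    ∃ g : 𝕜 → 𝕜, AnalyticAt 𝕜 g (f a) ∧ g (f a) = a ∧ deriv g (f a) = (deriv f a)⁻¹ ∧
      (∀ᶠ x in 𝓝 a, g (f x) = x) ∧ ∀ᶠ y in 𝓝 (f a), f (g y) = y :=
  have hs := hf.hasStrictDerivAt
  ⟨hs.localInverse _ _ _ ha, hf.analyticAt_localInverse ha,
    (hs.eventually_left_inverse ha).self_of_nhds, (hs.to_localInverse ha).hasDerivAt.deriv,
    hs.eventually_left_inverse ha, hs.eventually_right_inverse ha⟩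

theorem eventually_eq_const_of_hasDerivAt_zero {E : Type*} [NormedAddCommGroup E]
    [NormedSpace ℝ E] {f : ℝ → E} {x : ℝ} (hf : ∀ᶠ y in 𝓝 x, HasDerivAt f 0 y) :
    ∀ᶠ y in 𝓝 x, f y = f x := by
  obtain ⟨r, hr, h⟩ := Metric.eventually_nhds_iff_ball.1 hf
  filter_upwards [Metric.ball_mem_nhds x hr] with y hy
  exact Metric.isOpen_ball.is_const_of_deriv_eq_zero (convex_ball x r).isPreconnected
    (fun z hz => (h z hz).differentiableAt.differentiableWithinAt) (fun z hz => (h z hz).deriv)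
    hy (Metric.mem_ball_self hr)

theorem exists_complex_extension {f : ℝ → ℂ} {x : ℝ} (hf : AnalyticAt ℝ f x) :
    ∃ F : ℂ → ℂ, AnalyticAt ℂ F x ∧ ∀ᶠ y : ℝ in 𝓝 x, F y = f y := by
  obtain ⟨p, r, hp⟩ := hf
  set q : FormalMultilinearSeries ℂ ℂ ℂ := .ofScalars ℂ p.coeff
  have hnorm : ∀ n, ‖q n‖ = ‖p n‖ := fun n => by
    rw [FormalMultilinearSeries.ofScalars_norm, FormalMultilinearSeries.norm_apply_eq_norm_coef]
  have hradius : q.radius = p.radius := by simp only [FormalMultilinearSeries.radius, hnorm]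
  have hball := q.hasFPowerSeriesOnBall (by rw [hradius]; exact hp.r_pos.trans_le hp.r_le)
  have hF := hball.analyticAt
  refine ⟨fun z => q.sum (z - x), ?_, ?_⟩
  · rw [show (0 : ℂ) = x - x by simp] at hF
    exact hF.fun_comp (f := fun z : ℂ => z - x) (analyticAt_id.fun_sub analyticAt_const)
  · filter_upwards [hp.eventually_hasSum_sub] with y hy
    rw [← hy.tsum_eq, FormalMultilinearSeries.sum]
    congr! 2 with n
    simp [q, mul_comm]

theorem analyticAt_of_eventually_hasDerivAt {f g : ℝ → ℂ} {x : ℝ} (hg : AnalyticAt ℝ g x)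
    (hf : ∀ᶠ y in 𝓝 x, HasDerivAt f (g y) y) : AnalyticAt ℝ f x := by
  obtain ⟨G, hG, hGg⟩ := exists_complex_extension hg
  obtain ⟨r, hr, hGr⟩ := Metric.eventually_nhds_iff_ball.1 hG.eventually_analyticAt
  have hd : DifferentiableOn ℂ G (Metric.ball (x : ℂ) r) := fun z hz =>
    (hGr z hz).differentiableAt.differentiableWithinAt
  obtain ⟨F, hF⟩ := hd.isExactOn_ball
  have hFan : AnalyticAt ℂ F x :=
    DifferentiableOn.analyticAt (fun z hz => (hF z hz).differentiableAt.differentiableWithinAt)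
      (Metric.ball_mem_nhds _ hr)
  have hFx : AnalyticAt ℝ (fun y : ℝ => F y) x :=
    hFan.restrictScalars.fun_comp (f := fun y : ℝ => (y : ℂ)) (Complex.ofRealCLM.analyticAt x)
  have hball : ∀ᶠ y : ℝ in 𝓝 x, (y : ℂ) ∈ Metric.ball (x : ℂ) r :=
    Complex.continuous_ofReal.continuousAt.eventually (Metric.ball_mem_nhds _ hr)
  have hconst := eventually_eq_const_of_hasDerivAt_zero (f := fun y => f y - F y) (x := x) (by
    filter_upwards [hf, hGg, hball] with y hy hGy hyr
    simpa [hGy] using hy.fun_sub (hF y hyr).comp_ofReal)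
  refine (hFx.fun_add (analyticAt_const (v := f x - F x))).congr ?_
  filter_upwards [hconst] with y hy
  rw [← hy]
  ring

theorem analyticAt_norm_comp {f : ℝ → ℂ} {t : ℝ} (hf : AnalyticAt ℝ f t) (h0 : f t ≠ 0) :
    AnalyticAt ℝ (fun s => ‖f s‖) t :=
  (contDiffAt_norm ℝ h0).analyticAt.comp hf

theorem exists_Icc_subset_of_isOpen {a b : ℝ} (hab : a ≤ b) {U : Set ℝ} (hU : IsOpen U)
    (h : Icc a b ⊆ U) : ∃ δ > 0, Icc (a - δ) (b + δ) ⊆ U := by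
  obtain ⟨δ, hδ, hδU⟩ := isCompact_Icc.exists_cthickening_subset_open hU h
  refine ⟨δ, hδ, fun t ht => hδU ?_⟩
  refine Metric.mem_cthickening_of_dist_le t _ δ _ (projIcc a b hab t).2 ?_
  rw [Real.dist_eq, coe_projIcc, abs_le]
  grind

theorem exists_strictMono_hasDerivAt {v : ℝ → ℝ} {a b : ℝ} (hab : a ≤ b)
    (hv : AnalyticOnNhd ℝ v (Icc a b)) (hpos : ∀ t ∈ Icc a b, 0 < v t) (c : ℝ) :
    ∃ l : ℝ → ℝ, StrictMono l ∧ l c = 0 ∧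
      ∀ t ∈ Icc a b, AnalyticAt ℝ l t ∧ HasDerivAt l (v t) t := by
  have hU : IsOpen {t | AnalyticAt ℝ v t ∧ 0 < v t} := isOpen_iff_eventually.2 fun t ht =>
    ht.1.eventually_analyticAt.and (ht.1.continuousAt.eventually (lt_mem_nhds ht.2))
  obtain ⟨δ, hδ, hδU⟩ := exists_Icc_subset_of_isOpen hab hU fun t ht => ⟨hv t ht, hpos t ht⟩
  have hle : a - δ ≤ b + δ := by linarith
  set u : ℝ → ℝ := fun t => v (projIcc (a - δ) (b + δ) hle t)
  have hu : Continuous u := (ContinuousOn.domRestrict fun t ht =>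
    (hδU ht).1.continuousAt.continuousWithinAt).comp continuous_projIcc
  have hl : ∀ t, HasDerivAt (fun t => ∫ s in c..t, u s) (u t) t := fun t =>
    intervalIntegral.integral_hasDerivAt_right (hu.intervalIntegrable _ _)
      (hu.stronglyMeasurableAtFilter _ _) hu.continuousAt
  refine ⟨_, strictMono_of_hasDerivAt_pos hl fun t => (hδU (Subtype.mem _)).2,
    intervalIntegral.integral_same, fun t ht => ?_⟩
  have huv : u =ᶠ[𝓝 t] v := by
    filter_upwards [Icc_mem_nhds (a := a - δ) (b := b + δ) (by linarith [ht.1])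
      (by linarith [ht.2])] with s hs
    exact congrArg v (congrArg Subtype.val (projIcc_of_mem hle hs))
  refine ⟨?_, huv.self_of_nhds ▸ hl t⟩
  have hvC : AnalyticAt ℝ (fun s => (v s : ℂ)) t := (Complex.ofRealCLM.analyticAt _).comp (hv t ht)
  have := analyticAt_of_eventually_hasDerivAt hvC
    (huv.mono fun s hs => by simpa [hs] using (hl s).ofReal_comp)
  exact (Complex.reCLM.analyticAt _).comp this

end Analysis

section PolynomialDensity

open Polynomial

theorem sub_C_ne_zero_of_natDegree_pos {R : Type*} [Ring R] {T : R[X]} (hT : 0 < T.natDegree)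
    (c : R) : T - C c ≠ 0 := fun h => by
  rw [sub_eq_zero.1 h, natDegree_C] at hT
  exact hT.false

variable {K : Set ℂ}

theorem mem_topologicalClosure_polynomialFunctions_iff [CompactSpace K] {f : C(K, ℂ)} :
    f ∈ (polynomialFunctions K).topologicalClosure ↔
      ∀ ε > 0, ∃ p : ℂ[X], ∀ z : K, ‖p.eval (z : ℂ) - f z‖ < ε := by
  rw [← SetLike.mem_coe, Subalgebra.topologicalClosure_coe, Metric.mem_closure_iff]
  refine forall₂_congr fun ε hε => ?_
  simp_rw [dist_comm f, ContinuousMap.dist_lt_iff hε, dist_eq_norm, polynomialFunctions]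
  simp

theorem comp_re_eval_mem_topologicalClosure_polynomialFunctions [CompactSpace K] {T : ℂ[X]}
    (hT : ∀ z ∈ K, (T.eval z).im = 0) (c : C(ℝ, ℂ)) :
    (⟨fun z => c (T.eval (z : ℂ)).re, by fun_prop⟩ : C(K, ℂ)) ∈
      (polynomialFunctions K).topologicalClosure := by
  refine mem_topologicalClosure_polynomialFunctions_iff.2 fun ε hε => ?_
  have hu : Continuous fun z : K => (T.eval (z : ℂ)).re := by fun_prop
  obtain ⟨R, hR⟩ := (isCompact_range hu).isBounded.subset_closedBall 0
  have approx (g : ℝ → ℝ) (hg : Continuous g) :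
      ∃ p : ℝ[X], ∀ z : K, |p.eval (T.eval (z : ℂ)).re - g (T.eval (z : ℂ)).re| < ε / 2 := by
    obtain ⟨p, hp⟩ :=
      exists_polynomial_near_of_continuousOn (-R) R g hg.continuousOn _ (half_pos hε)
    exact ⟨p, fun z => hp _ (by simpa [abs_le] using hR (mem_range_self z))⟩
  obtain ⟨p, hp⟩ := approx (fun x => (c x).re) (by fun_prop)
  obtain ⟨q, hq⟩ := approx (fun x => (c x).im) (by fun_prop)
  refine ⟨(p.map Complex.ofRealHom + C Complex.I * q.map Complex.ofRealHom).comp T, fun z => ?_⟩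
  have hz : T.eval (z : ℂ) = ((T.eval (z : ℂ)).re : ℂ) := Complex.ext rfl (hT z z.2)
  have hmap (r : ℝ[X]) : (r.map Complex.ofRealHom).eval (T.eval (z : ℂ)) =
      (r.eval (T.eval (z : ℂ)).re : ℝ) := by
    conv_lhs => rw [hz]
    exact r.eval_map_apply Complex.ofRealHom _
  refine (Complex.norm_le_abs_re_add_abs_im _).trans_lt ?_
  simpa [hmap] using add_lt_add (hp z) (hq z)

theorem exists_polynomial_eventually_near_on_fiber {u : ℂ → ℝ} {f : ℂ → ℂ} {n : ℕ} {x ε : ℝ}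
    (hK : IsCompact K) (hu : ContinuousOn u K) (hf : ContinuousOn f K) {s : Finset ℂ}
    (hs : ∀ z ∈ K, u z = x → z ∈ s) (hn : s.card ≤ n) (hε : 0 < ε) :
    ∃ c : Fin n → ℂ, ∀ᶠ y in 𝓝 x, ∀ z ∈ K, u z = y → ‖f z - ∑ j, c j * z ^ (j : ℕ)‖ < ε := by
  set P := Lagrange.interpolate s id f
  have hsum (z : ℂ) : ∑ j : Fin n, P.coeff j * z ^ (j : ℕ) = P.eval z := by
    have hdeg : P.degree < n :=
      (Lagrange.degree_interpolate_lt f (injOn_id _)).trans_le (by exact_mod_cast hn)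
    rw [eval_eq_sum, ← sum_fin (fun j a => a * z ^ j) (by simp) hdeg]
  have hbad : IsCompact (K ∩ {z | ε ≤ ‖f z - P.eval z‖}) := by
    have hg : ContinuousOn (fun z => ‖f z - P.eval z‖) K := (hf.sub P.continuousOn).norm
    exact hK.of_isClosed_subset (hg.preimage_isClosed_of_isClosed hK.isClosed isClosed_Ici)
      inter_subset_left
  have hx : x ∉ u '' (K ∩ {z | ε ≤ ‖f z - P.eval z‖}) := by
    rintro ⟨z, ⟨hzK, hz⟩, hzx⟩
    have hPz : P.eval z = f z :=
      Lagrange.eval_interpolate_at_node (v := id) f (injOn_id _) (hs z hzK hzx)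
    have : ε ≤ ‖f z - P.eval z‖ := hz
    simp only [hPz, sub_self, norm_zero] at this
    exact this.not_gt hε
  refine ⟨fun j => P.coeff j, ?_⟩
  filter_upwards [(hbad.image_of_continuousOn (hu.mono inter_subset_left)).isClosed.compl_mem_nhds
    hx] with y hy z hzK hzy
  rw [hsum]
  exact lt_of_not_ge fun h => hy ⟨z, ⟨hzK, h⟩, hzy⟩

theorem convex_setOf_norm_sub_sum_mul_pow_lt (K : Set ℂ) (u : ℂ → ℝ) (f : ℂ → ℂ) (ε : ℝ) {n : ℕ}
    (x : ℝ) : Convex ℝ {c : Fin n → ℂ |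
      ∀ z ∈ K, u z = x → ‖f z - ∑ j, c j * z ^ (j : ℕ)‖ < ε} := by
  simp only [ofPred_forall]
  refine convex_iInter fun z => convex_iInter fun _ => convex_iInter fun _ => ?_
  have := (convex_ball (f z) ε).linear_preimage
    (∑ j : Fin n, (LinearMap.mulRight ℝ (z ^ (j : ℕ))).comp (LinearMap.proj j))
  simpa [preimage, dist_comm, dist_eq_norm] using this

theorem polynomialFunctions_topologicalClosure_eq_top [CompactSpace K] {T : ℂ[X]}
    (hT : 0 < T.natDegree) (him : ∀ z ∈ K, (T.eval z).im = 0) :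
    (polynomialFunctions K).topologicalClosure = ⊤ := by
  set A := (polynomialFunctions K).topologicalClosure
  refine Algebra.eq_top_iff.2 fun f => ?_
  obtain ⟨F, hF⟩ : ∃ F : ℂ → ℂ, ∀ z : K, F z = f z :=
    ⟨Function.extend (↑) f 0, fun z => Subtype.val_injective.extend_apply f 0 z⟩
  have hFc : ContinuousOn F K := continuousOn_iff_continuous_domRestrict.2
    (f.continuous.congr fun z => (hF z).symm)
  rw [← SetLike.mem_coe, ← (polynomialFunctions K).isClosed_topologicalClosure.closure_eq]
  refine Metric.mem_closure_iff.2 fun ε hε => ?_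
  have hconst (x : ℝ) : ∃ c : Fin T.natDegree → ℂ, ∀ᶠ y in 𝓝 x,
      ∀ z ∈ K, (T.eval z).re = y → ‖F z - ∑ j, c j * z ^ (j : ℕ)‖ < ε := by
    refine exists_polynomial_eventually_near_on_fiber (isCompact_iff_compactSpace.2 ‹_›)
      (by fun_prop) hFc (s := (T - C (x : ℂ)).roots.toFinset) (fun z hz hzx => ?_) ?_ hε
    · simpa [sub_C_ne_zero_of_natDegree_pos hT, sub_eq_zero] using Complex.ext hzx (him z hz)
    · exact (Multiset.toFinset_card_le _).trans ((card_roots' _).trans natDegree_sub_C.le)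
  obtain ⟨c, hc⟩ := exists_continuous_forall_mem_convex_of_local_const
    (convex_setOf_norm_sub_sum_mul_pow_lt K _ F ε) hconst
  set ι : C(K, ℂ) := ⟨fun z => z, by fun_prop⟩
  have hι : ι ∈ A := (polynomialFunctions K).le_topologicalClosure ⟨X, ⟨⟩, by ext; simp; rfl⟩
  refine ⟨∑ j, (⟨fun z => c (T.eval (z : ℂ)).re j, by fun_prop⟩ : C(K, ℂ)) * ι ^ (j : ℕ), ?_, ?_⟩
  · refine sum_mem fun j _ => mul_mem ?_ (pow_mem hι _)
    exact comp_re_eval_mem_topologicalClosure_polynomialFunctions him ⟨fun x => c x j, by fun_prop⟩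
  · rw [ContinuousMap.dist_lt_iff hε]
    intro z
    simpa [dist_eq_norm, hF, ι] using hc _ z z.2 rfl

end PolynomialDensity

section ImmersedLoops

open ComplexConjugate

variable {γ : ℝ → ℂ} {a b : ℝ}

theorem eventually_injective_of_deriv_ne_zero {p : ℝ} (hγ : AnalyticAt ℝ γ p)
    (h0 : deriv γ p ≠ 0) : ∀ᶠ x : ℝ × ℝ in 𝓝 (p, p), γ x.1 = γ x.2 → x.1 = x.2 := by
  have hlo := hasStrictFDerivAt_iff_isLittleO.1 hγ.hasStrictDerivAt
  filter_upwards [hlo.def (half_pos (norm_pos_iff.2 h0))] with x hx hxe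
  rw [hxe, sub_self, zero_sub, norm_neg, ContinuousLinearMap.toSpanSingleton_apply,
    norm_smul] at hx
  by_contra hne
  nlinarith [norm_pos_iff.2 h0, norm_pos_iff.2 (sub_ne_zero.2 hne)]

theorem exists_simple_loop_of_not_injOn (hγ : ContinuousOn γ (Icc a b))
    (hloc : ∀ t ∈ Icc a b, ∀ᶠ x : ℝ × ℝ in 𝓝 (t, t), γ x.1 = γ x.2 → x.1 = x.2)
    (hinj : ¬ InjOn γ (Icc a b)) :
    ∃ c d, a ≤ c ∧ c < d ∧ d ≤ b ∧ γ c = γ d ∧ InjOn γ (Ico c d) := by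
  set W : Set (ℝ × ℝ) := {p | ∀ᶠ x in 𝓝 p, γ x.1 = γ x.2 → x.1 = x.2}
  have hW : IsOpen W := isOpen_iff_eventually.2 fun p hp => eventually_eventually_nhds.2 hp
  set D : Set (ℝ × ℝ) := Icc a b ×ˢ Icc a b ∩ (fun p => γ p.1 - γ p.2) ⁻¹' {0}
  have hD : IsCompact D := by
    have hf : ContinuousOn (fun p : ℝ × ℝ => γ p.1 - γ p.2) (Icc a b ×ˢ Icc a b) :=
      (hγ.comp continuousOn_fst fun p hp => hp.1).sub (hγ.comp continuousOn_snd fun p hp => hp.2)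
    exact (isCompact_Icc.prod isCompact_Icc).of_isClosed_subset
      (hf.preimage_isClosed_of_isClosed (isClosed_Icc.prod isClosed_Icc) isClosed_singleton)
      inter_subset_left
  have hK : IsCompact (D ∩ {p | p.1 ≤ p.2} ∩ Wᶜ) :=
    (hD.inter_right (isClosed_le continuous_fst continuous_snd)).inter_right hW.isClosed_compl
  have hmem {x y : ℝ} (hx : x ∈ Icc a b) (hy : y ∈ Icc a b) (hxy : x < y) (he : γ x = γ y) :
      (x, y) ∈ D ∩ {p | p.1 ≤ p.2} ∩ Wᶜ :=
    ⟨⟨⟨⟨hx, hy⟩, sub_eq_zero.2 he⟩, hxy.le⟩, fun h => hxy.ne (h.self_of_nhds he)⟩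
  have hne : (D ∩ {p | p.1 ≤ p.2} ∩ Wᶜ).Nonempty := by
    simp only [InjOn, not_forall] at hinj
    obtain ⟨x, hx, y, hy, he, hxy⟩ := hinj
    rcases lt_or_gt_of_ne hxy with h | h
    exacts [⟨_, hmem hx hy h he⟩, ⟨_, hmem hy hx h he.symm⟩]
  obtain ⟨⟨c, d⟩, ⟨⟨⟨⟨hc, hd⟩, he⟩, hle⟩, hnW⟩, hmin⟩ := hK.exists_isMinOn hne
    (f := fun p : ℝ × ℝ => p.2 - p.1) (by fun_prop)
  have hcd : c ≠ d := by rintro rfl; exact hnW (hloc c hc)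
  have hlen {x y : ℝ} (hx : x ∈ Ico c d) (hy : y ∈ Ico c d) (h : x < y) : γ x ≠ γ y := fun hxy => by
    have : d - c ≤ y - x := hmin (hmem ⟨hc.1.trans hx.1, hx.2.le.trans hd.2⟩
      ⟨hc.1.trans hy.1, hy.2.le.trans hd.2⟩ h hxy)
    linarith [hx.1, hy.2]
  refine ⟨c, d, hc.1, lt_of_le_of_ne hle hcd, hd.2, sub_eq_zero.1 he, fun x hx y hy hxy => ?_⟩
  rcases lt_trichotomy x y with h | h | h
  exacts [(hlen hx hy h hxy).elim, h, (hlen hy hx h hxy.symm).elim]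

theorem integral_eval_mul_deriv_eq_zero (p : Polynomial ℂ) (hab : a ≤ b)
    (hγ : AnalyticOnNhd ℝ γ (Icc a b)) (hcl : γ a = γ b) :
    ∫ t in a..b, p.eval (γ t) * deriv γ t = 0 := by
  obtain ⟨F, hF⟩ := p.differentiable.isExactOn_univ
  rw [← uIcc_of_le hab] at hγ
  have hd : ∀ t ∈ uIcc a b, HasDerivAt (F ∘ γ) (p.eval (γ t) * deriv γ t) t := fun t ht =>
    (hF (γ t) (mem_univ _)).comp t (hγ t ht).differentiableAt.hasDerivAt
  have hc : ContinuousOn (fun t => p.eval (γ t) * deriv γ t) (uIcc a b) :=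
    (p.continuous.comp_continuousOn hγ.continuousOn).mul hγ.deriv.continuousOn
  rw [intervalIntegral.integral_eq_sub_of_hasDerivAt hd hc.intervalIntegrable]
  simp [hcl]

theorem exists_polynomial_near_on_curve {T : Polynomial ℂ} (hT : 0 < T.natDegree)
    (hγ : ContinuousOn γ (Icc a b)) (him : ∀ t ∈ Icc a b, (T.eval (γ t)).im = 0) {h : ℝ → ℂ}
    (hh : ContinuousOn h (Icc a b)) (hfac : ∀ s ∈ Icc a b, ∀ t ∈ Icc a b, γ s = γ t → h s = h t)
    {ε : ℝ} (hε : 0 < ε) : ∃ p : Polynomial ℂ, ∀ t ∈ Icc a b, ‖p.eval (γ t) - h t‖ < ε := by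
  have : CompactSpace (γ '' Icc a b) :=
    isCompact_iff_compactSpace.1 (isCompact_Icc.image_of_continuousOn hγ)
  let π : C(Icc a b, γ '' Icc a b) :=
    ⟨fun t => ⟨γ t, mem_image_of_mem γ t.2⟩, hγ.domRestrict.subtype_mk _⟩
  have hπ : IsQuotientMap π := π.continuous.isClosedMap.isQuotientMap π.continuous
    (by rintro ⟨_, t, ht, rfl⟩; exact ⟨⟨t, ht⟩, rfl⟩)
  let h' : C(Icc a b, ℂ) := ⟨fun t => h t, hh.domRestrict⟩
  have hfac' : Function.FactorsThrough h' π := fun s t hst =>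
    hfac s s.2 t t.2 (congrArg Subtype.val hst)
  let f := hπ.lift h' hfac'
  have hdense := polynomialFunctions_topologicalClosure_eq_top hT (K := γ '' Icc a b)
    (forall_mem_image.2 him)
  obtain ⟨p, hp⟩ := mem_topologicalClosure_polynomialFunctions_iff.1
    (hdense.ge (Algebra.mem_top (x := f))) ε hε
  refine ⟨p, fun t ht => ?_⟩
  have hft : f (π ⟨t, ht⟩) = h t := DFunLike.congr_fun (hπ.lift_comp h' hfac') ⟨t, ht⟩
  rw [← hft]
  exact hp (π ⟨t, ht⟩)

theorem integral_mul_deriv_eq_zero {T : Polynomial ℂ} (hT : 0 < T.natDegree) (hab : a ≤ b)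
    (hγ : AnalyticOnNhd ℝ γ (Icc a b)) (hcl : γ a = γ b)
    (him : ∀ t ∈ Icc a b, (T.eval (γ t)).im = 0) {h : ℝ → ℂ} (hh : ContinuousOn h (Icc a b))
    (hfac : ∀ s ∈ Icc a b, ∀ t ∈ Icc a b, γ s = γ t → h s = h t) :
    ∫ t in a..b, h t * deriv γ t = 0 := by
  obtain ⟨M, hM⟩ := isCompact_Icc.exists_bound_of_continuousOn hγ.deriv.continuousOn
  have hint {g : ℝ → ℂ} (hg : ContinuousOn g (Icc a b)) :
      IntervalIntegrable (fun t => g t * deriv γ t) MeasureTheory.volume a b :=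
    ((hg.mul hγ.deriv.continuousOn).mono (uIcc_of_le hab).le).intervalIntegrable
  have hle (ε : ℝ) (hε : 0 < ε) : ‖∫ t in a..b, h t * deriv γ t‖ ≤ ε * (M * (b - a)) := by
    obtain ⟨p, hp⟩ := exists_polynomial_near_on_curve hT hγ.continuousOn him hh hfac hε
    have hsub : ∫ t in a..b, h t * deriv γ t = ∫ t in a..b, (h t - p.eval (γ t)) * deriv γ t := by
      simp_rw [sub_mul]
      rw [intervalIntegral.integral_sub (hint hh)
        (hint (g := fun t => p.eval (γ t)) (p.continuous.comp_continuousOn hγ.continuousOn)),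
        integral_eval_mul_deriv_eq_zero p hab hγ hcl, sub_zero]
    rw [hsub, ← mul_assoc, ← abs_of_nonneg (sub_nonneg.2 hab)]
    refine intervalIntegral.norm_integral_le_of_norm_le_const fun t ht => ?_
    rw [uIoc_of_le hab] at ht
    rw [norm_mul, norm_sub_rev]
    have ht' := Ioc_subset_Icc_self ht
    exact mul_le_mul (hp t ht').le (hM t ht') (norm_nonneg _) hε.le
  have hlim : Tendsto (fun ε : ℝ => ε * (M * (b - a))) (𝓝[>] 0) (𝓝 0) := by
    refine tendsto_nhdsWithin_of_tendsto_nhds (Continuous.tendsto' (by fun_prop) _ _ (by simp))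
  exact norm_le_zero_iff.1 (ge_of_tendsto hlim (eventually_mem_nhdsWithin.mono hle))

theorem injOn_of_im_eval_eq_zero {T : Polynomial ℂ} (hT : 0 < T.natDegree)
    (hγ : AnalyticOnNhd ℝ γ (Icc a b)) (h0 : ∀ t ∈ Icc a b, deriv γ t ≠ 0)
    (him : ∀ t ∈ Icc a b, (T.eval (γ t)).im = 0) : InjOn γ (Icc a b) := by
  by_contra hinj
  obtain ⟨c, d, hac, hcd, hdb, hcl, hmin⟩ := exists_simple_loop_of_not_injOn hγ.continuousOn
    (fun t ht => eventually_injective_of_deriv_ne_zero (hγ t ht) (h0 t ht)) hinj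
  have hsub : Icc c d ⊆ Icc a b := Icc_subset_Icc hac hdb
  have hγ' := (hγ.mono hsub).deriv.continuousOn
  set h : ℝ → ℂ := fun t => ((t - c) * (d - t) : ℝ) * conj (deriv γ t) with hh
  have hfac : ∀ s ∈ Icc c d, ∀ t ∈ Icc c d, γ s = γ t → h s = h t := by
    intro s hs t ht hst
    rcases hs.2.eq_or_lt with rfl | hsd <;> rcases ht.2.eq_or_lt with rfl | htd
    · rfl
    · simp [hh, hmin ⟨le_rfl, hcd⟩ ⟨ht.1, htd⟩ (hcl.trans hst)]
    · simp [hh, hmin ⟨hs.1, hsd⟩ ⟨le_rfl, hcd⟩ (hst.trans hcl.symm)]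
    · rw [hmin ⟨hs.1, hsd⟩ ⟨ht.1, htd⟩ hst]
  have hint := integral_mul_deriv_eq_zero hT hcd.le (hγ.mono hsub) hcl (fun t ht => him t (hsub ht))
    (h := h) (ContinuousOn.mul (by fun_prop) (Complex.continuous_conj.comp_continuousOn hγ')) hfac
  have hnormSq (t : ℝ) : h t * deriv γ t = ((t - c) * (d - t) * ‖deriv γ t‖ ^ 2 : ℝ) := by
    rw [hh, mul_assoc, Complex.conj_mul']
    push_cast
    ring
  simp_rw [hnormSq, intervalIntegral.integral_ofReal, Complex.ofReal_eq_zero] at hint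
  refine hint.not_gt (intervalIntegral.intervalIntegral_pos_of_pos_on ?_ (fun t ht => ?_) hcd)
  · exact ContinuousOn.intervalIntegrable_of_Icc hcd.le (by fun_prop)
  · exact mul_pos (mul_pos (sub_pos.2 ht.1) (sub_pos.2 ht.2))
      (pow_pos (norm_pos_iff.2 (h0 t (hsub (Ioo_subset_Icc_self ht)))) 2)

end ImmersedLoops

section NormalForm

open Polynomial

variable {T : ℂ[X]} {z₀ : ℂ}

/-- The local degree of the map `T` at `z₀`: the order of vanishing of `T - T z₀` at `z₀`. -/
noncomputable def localDegree (T : ℂ[X]) (z₀ : ℂ) : ℕ :=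
  (T - C (T.eval z₀)).rootMultiplicity z₀

theorem localDegree_pos (hT : 0 < T.natDegree) (z₀ : ℂ) : 0 < localDegree T z₀ :=
  (rootMultiplicity_pos (sub_C_ne_zero_of_natDegree_pos hT _)).2 (by simp)

/-- `φ` is a local coordinate at `z₀`, with inverse `ψ`, in which `T` is `w ↦ T z₀ + w ^ m`, where
`m` is the local degree. -/
structure IsNormalForm (T : ℂ[X]) (z₀ : ℂ) (φ ψ : ℂ → ℂ) : Prop where
  analytic : AnalyticAt ℂ φ z₀
  analytic_symm : AnalyticAt ℂ ψ 0
  apply_base : φ z₀ = 0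
  symm_apply_zero : ψ 0 = z₀
  deriv_symm_ne : deriv ψ 0 ≠ 0
  deriv_eq : deriv φ z₀ = (deriv ψ 0)⁻¹
  left_inv : ∀ᶠ z in 𝓝 z₀, ψ (φ z) = z
  right_inv : ∀ᶠ w in 𝓝 0, φ (ψ w) = w
  eval_eq : ∀ᶠ z in 𝓝 z₀, T.eval z = T.eval z₀ + φ z ^ localDegree T z₀

theorem exists_analyticAt_pow_eq {f : ℂ → ℂ} (hf : AnalyticAt ℂ f z₀) (h0 : f z₀ ≠ 0) {m : ℕ}
    (hm : m ≠ 0) : ∃ k : ℂ → ℂ, AnalyticAt ℂ k z₀ ∧ ∀ᶠ z in 𝓝 z₀, k z ^ m = f z := by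
  obtain ⟨c, hc⟩ := IsAlgClosed.exists_pow_nat_eq (f z₀) (Nat.pos_of_ne_zero hm)
  have hm' : (m : ℂ) ≠ 0 := by exact_mod_cast hm
  refine ⟨fun z => c * Complex.exp (Complex.log (f z / f z₀) / m), ?_, ?_⟩
  · exact analyticAt_const.mul ((hf.div_const.clog (by simp [h0])).div_const).cexp
  · filter_upwards [hf.continuousAt.eventually_ne h0] with z hz
    rw [mul_pow, ← Complex.exp_nat_mul, mul_div_cancel₀ _ hm', Complex.exp_log (div_ne_zero hz h0),
      hc, mul_div_cancel₀ _ h0]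

theorem exists_isNormalForm (hT : 0 < T.natDegree) (z₀ : ℂ) : ∃ φ ψ, IsNormalForm T z₀ φ ψ := by
  obtain ⟨R, hR, hRd⟩ := exists_eq_pow_rootMultiplicity_mul_and_not_dvd _
    (sub_C_ne_zero_of_natDegree_pos hT (T.eval z₀)) z₀
  have hR0 : R.eval z₀ ≠ 0 := fun h => hRd (dvd_iff_isRoot.2 h)
  have hm := (localDegree_pos hT z₀).ne'
  obtain ⟨k, hk, hkm⟩ := exists_analyticAt_pow_eq (R.differentiable.analyticAt z₀) hR0 hm
  have hk0 : k z₀ ≠ 0 := fun h => hR0 (by rw [← hkm.self_of_nhds, h, zero_pow hm])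
  set φ : ℂ → ℂ := fun z => (z - z₀) * k z
  have hφ : AnalyticAt ℂ φ z₀ := (analyticAt_id.sub analyticAt_const).mul hk
  have hφ0 : φ z₀ = 0 := by simp [φ]
  have hφd : deriv φ z₀ = k z₀ := by
    simpa using (((hasDerivAt_id' z₀).sub_const z₀).fun_mul hk.differentiableAt.hasDerivAt).deriv
  obtain ⟨ψ, hψ, hψ0, hψd, hl, hr⟩ := exists_analyticAt_localInverse hφ (hφd ▸ hk0)
  rw [hφ0] at hψ hψ0 hψd hr
  refine ⟨φ, ψ, hφ, hψ, hφ0, hψ0, by simp [hψd, hφd, hk0], by rw [hψd, inv_inv], hl, hr, ?_⟩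
  filter_upwards [hkm] with z hz
  have hTz : T.eval z - T.eval z₀ = (z - z₀) ^ localDegree T z₀ * R.eval z := by
    simpa [localDegree] using congrArg (Polynomial.eval z) hR
  rw [mul_pow, hz, ← hTz, add_sub_cancel]

theorem rootMultiplicity_sq_sub_one (hT : 0 < T.natDegree) (h : (T ^ 2 - 1).IsRoot z₀) :
    (T ^ 2 - 1).rootMultiplicity z₀ = localDegree T z₀ := by
  have hsq : T.eval z₀ ^ 2 = 1 := by simpa [IsRoot.def, sub_eq_zero] using h
  have hfac : T ^ 2 - 1 = (T - C (T.eval z₀)) * (T - C (-T.eval z₀)) := by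
    have hC : C (T.eval z₀) ^ 2 = 1 := by rw [← C_pow, hsq, C_1]
    rw [C_neg]
    linear_combination hC
  have hne := mul_ne_zero (sub_C_ne_zero_of_natDegree_pos hT (T.eval z₀))
    (sub_C_ne_zero_of_natDegree_pos hT (-T.eval z₀))
  have h0 : ¬ (T - C (-T.eval z₀)).IsRoot z₀ := fun h => by
    have : T.eval z₀ = 0 := by simpa [IsRoot.def] using h
    simp [this] at hsq
  rw [hfac, rootMultiplicity_mul hne, rootMultiplicity_eq_zero h0, add_zero, localDegree]

end NormalForm

section DirectionCone

variable {T : Polynomial ℂ} {z₀ w : ℂ} {φ ψ : ℂ → ℂ}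

/-- The tangent cone of `inverseImage T` at one of its points `z₀`, read in the coordinate `φ` of a
normal form: `T z₀ + w ^ m` is real and, where `T z₀ = ±1`, lies on the inner side of `[-1, 1]`. -/
def directionCone (T : Polynomial ℂ) (z₀ : ℂ) : Set ℂ :=
  {w | ∃ y : ℝ, w ^ localDegree T z₀ = y ∧ (T.eval z₀ = 1 → y ≤ 0) ∧ (T.eval z₀ = -1 → 0 ≤ y)}

theorem ofReal_mul_mem_directionCone (hw : w ∈ directionCone T z₀) {r : ℝ} (hr : 0 ≤ r) :
    r * w ∈ directionCone T z₀ := by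
  obtain ⟨y, hy, h1, h2⟩ := hw
  refine ⟨r ^ localDegree T z₀ * y, by rw [mul_pow, hy]; push_cast; ring, fun h => ?_, fun h => ?_⟩
  · exact mul_nonpos_of_nonneg_of_nonpos (pow_nonneg hr _) (h1 h)
  · exact mul_nonneg (pow_nonneg hr _) (h2 h)

theorem isClosed_directionCone (T : Polynomial ℂ) (z₀ : ℂ) : IsClosed (directionCone T z₀) := by
  have hclosed : IsClosed {y : ℝ | (T.eval z₀ = 1 → y ≤ 0) ∧ (T.eval z₀ = -1 → 0 ≤ y)} :=
    (isClosed_imp isOpen_const isClosed_Iic).inter (isClosed_imp isOpen_const isClosed_Ici)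
  have himage := (Complex.isometry_ofReal.isClosedEmbedding.isClosedMap _ hclosed).preimage
    (continuous_pow (M := ℂ) (localDegree T z₀))
  convert himage using 1
  ext w
  simp only [directionCone, mem_preimage, mem_image, mem_ofPred_eq]
  grind

theorem eventually_add_mem_Icc_iff {x : ℝ} (hx : x ∈ Icc (-1 : ℝ) 1) :
    ∀ᶠ y in 𝓝 (0 : ℝ), x + y ∈ Icc (-1 : ℝ) 1 ↔ (x = 1 → y ≤ 0) ∧ (x = -1 → 0 ≤ y) := by
  have hupper : ∀ᶠ y in 𝓝 (0 : ℝ), x < 1 → x + y ≤ 1 := by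
    rcases hx.2.eq_or_lt with h | h
    · simp [h]
    · filter_upwards [ge_mem_nhds (sub_pos.2 h)] with y hy _ using by linarith
  have hlower : ∀ᶠ y in 𝓝 (0 : ℝ), -1 < x → -1 ≤ x + y := by
    rcases hx.1.eq_or_lt with h | h
    · simp [h]
    · filter_upwards [le_mem_nhds (show -1 - x < 0 by linarith)] with y hy _ using by linarith
  filter_upwards [hupper, hlower] with y hu hl
  grind

namespace IsNormalForm

theorem tendsto_symm (hN : IsNormalForm T z₀ φ ψ) : Tendsto ψ (𝓝 0) (𝓝 z₀) := by
  simpa [hN.symm_apply_zero] using hN.analytic_symm.continuousAt.tendsto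

theorem tendsto (hN : IsNormalForm T z₀ φ ψ) : Tendsto φ (𝓝 z₀) (𝓝 0) := by
  simpa [hN.apply_base] using hN.analytic.continuousAt.tendsto

theorem eventually_eval_symm (hN : IsNormalForm T z₀ φ ψ) :
    ∀ᶠ w in 𝓝 0, T.eval (ψ w) = T.eval z₀ + w ^ localDegree T z₀ := by
  filter_upwards [hN.tendsto_symm.eventually hN.eval_eq, hN.right_inv] with w hw hr
  rw [hw, hr]

theorem eventually_symm_mem_inverseImage_iff (hN : IsNormalForm T z₀ φ ψ) (hT : 0 < T.natDegree)
    (hz₀ : z₀ ∈ inverseImage T) :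
    ∀ᶠ w in 𝓝 0, ψ w ∈ inverseImage T ↔ w ∈ directionCone T z₀ := by
  obtain ⟨x, hx, hTx⟩ := hz₀
  have hpow : Tendsto (fun w : ℂ => (w ^ localDegree T z₀).re) (𝓝 0) (𝓝 0) := by
    refine Continuous.tendsto' (by fun_prop) _ _ ?_
    simp [(localDegree_pos hT z₀).ne']
  filter_upwards [hN.eventually_eval_symm, hpow.eventually (eventually_add_mem_Icc_iff hx)]
    with w hw hy
  have h1 : T.eval z₀ = 1 ↔ x = 1 := by rw [hTx]; exact_mod_cast Iff.rfl
  have h2 : T.eval z₀ = -1 ↔ x = -1 := by rw [hTx]; exact_mod_cast Iff.rfl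
  simp only [inverseImage, directionCone, mem_ofPred_eq, hw, h1, h2]
  rw [hTx]
  constructor
  · rintro ⟨u, hu, hwu⟩
    have hpw : w ^ localDegree T z₀ = (u - x : ℝ) := by push_cast; linear_combination hwu
    rw [hpw, Complex.ofReal_re, add_sub_cancel] at hy
    exact ⟨u - x, hpw, hy.1 hu⟩
  · rintro ⟨y, hwy, hsign⟩
    rw [hwy, Complex.ofReal_re] at hy
    exact ⟨x + y, hy.2 hsign, by rw [hwy]; push_cast; rfl⟩

theorem div_deriv_mem_directionCone (hN : IsNormalForm T z₀ φ ψ) (hT : 0 < T.natDegree)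
    (hz₀ : z₀ ∈ inverseImage T) {c : ℝ → ℂ} (hc : HasDerivWithinAt c w (Ioi 0) 0) (hc0 : c 0 = z₀)
    (hcS : ∃ᶠ s in 𝓝[>] 0, c s ∈ inverseImage T) : w / deriv ψ 0 ∈ directionCone T z₀ := by
  have hφc : HasDerivWithinAt (φ ∘ c) (w / deriv ψ 0) (Ioi 0) 0 := by
    have hφ : HasDerivAt φ (deriv φ z₀) (c 0) := hc0 ▸ hN.analytic.differentiableAt.hasDerivAt
    rw [div_eq_inv_mul, ← hN.deriv_eq]
    exact hφ.comp_hasDerivWithinAt 0 hc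
  have hlim : Tendsto (fun s : ℝ => ((s⁻¹ : ℝ) : ℂ) * φ (c s)) (𝓝[>] 0) (𝓝 (w / deriv ψ 0)) := by
    have := (hasDerivWithinAt_iff_tendsto_slope' self_notMem_Ioi).1 hφc
    simpa [slope_fun_def, hc0, hN.apply_base] using this
  have hcz₀ : Tendsto c (𝓝[>] 0) (𝓝 z₀) := by simpa [hc0] using hc.continuousWithinAt.tendsto
  refine (isClosed_directionCone T z₀).mem_of_frequently_of_tendsto ?_ hlim
  have hiff := (hN.tendsto.comp hcz₀).eventually (hN.eventually_symm_mem_inverseImage_iff hT hz₀)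
  refine (hcS.and_eventually ((hcz₀.eventually hN.left_inv).and
    (hiff.and self_mem_nhdsWithin))).mono fun s ⟨hs, hl, hi, hpos⟩ => ?_
  exact ofReal_mul_mem_directionCone (hi.1 (by simpa [hl] using hs)) (inv_nonneg.2 hpos.le)

end IsNormalForm

theorem neg_mem_directionCone (h : (T ^ 2 - 1).IsRoot z₀ → Even (localDegree T z₀))
    (hw : w ∈ directionCone T z₀) : -w ∈ directionCone T z₀ := by
  obtain ⟨y, hy, h1, h2⟩ := hw
  rcases Nat.even_or_odd (localDegree T z₀) with he | ho
  · exact ⟨y, by rw [he.neg_pow, hy], h1, h2⟩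
  · have hroot : T.eval z₀ ≠ 1 ∧ T.eval z₀ ≠ -1 := by
      refine ⟨fun hz => ?_, fun hz => ?_⟩ <;>
        exact Nat.not_even_iff_odd.2 ho (h (by simp [Polynomial.IsRoot.def, hz]))
    exact ⟨-y, by rw [ho.neg_pow, hy]; simp, fun hz => (hroot.1 hz).elim,
      fun hz => (hroot.2 hz).elim⟩

theorem isRoot_sq_sub_one_iff : (T ^ 2 - 1).IsRoot z₀ ↔ T.eval z₀ = 1 ∨ T.eval z₀ = -1 := by
  simp [Polynomial.IsRoot.def, sub_eq_zero]

theorem even_localDegree_of_neg_mem_directionCone (hroot : (T ^ 2 - 1).IsRoot z₀) (hw0 : w ≠ 0)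
    (hw : w ∈ directionCone T z₀) (hnw : -w ∈ directionCone T z₀) : Even (localDegree T z₀) := by
  by_contra hodd
  obtain ⟨y, hy, h1, h2⟩ := hw
  obtain ⟨y', hy', h1', h2'⟩ := hnw
  have hyy' : y' = -y := by
    rw [(Nat.not_even_iff_odd.1 hodd).neg_pow, hy] at hy'
    exact_mod_cast hy'.symm
  have hy0 : y = 0 := by
    rcases isRoot_sq_sub_one_iff.1 hroot with h | h
    · linarith [h1 h, h1' h]
    · linarith [h2 h, h2' h]
  exact hw0 (eq_zero_of_pow_eq_zero (by simpa [hy0] using hy))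

/-- The directions of `directionCone T z₀`, as complex numbers of modulus one. -/
def unitDirections (T : Polynomial ℂ) (z₀ : ℂ) : Set ℂ :=
  directionCone T z₀ ∩ {ω | ‖ω‖ = 1}

theorem finite_unitDirections (hT : 0 < T.natDegree) (z₀ : ℂ) : (unitDirections T z₀).Finite := by
  have hm := localDegree_pos hT z₀
  refine (Polynomial.nthRoots (2 * localDegree T z₀) (1 : ℂ)).toFinset.finite_toSet.subset ?_
  rintro ω ⟨⟨y, hy, -⟩, hω⟩
  have hy1 : |y| = 1 := by simpa [hω.out] using (congrArg norm hy).symm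
  have : ω ^ (2 * localDegree T z₀) = 1 := by
    rw [mul_comm, pow_mul, hy, ← Complex.ofReal_pow, ← sq_abs, hy1]; simp
  simpa [Polynomial.mem_nthRoots (show 0 < 2 * localDegree T z₀ by omega)] using this

theorem ncard_setOf_pow_eq {m : ℕ} (hm : m ≠ 0) {a : ℂ} (ha : a ≠ 0) :
    {ω : ℂ | ω ^ m = a}.ncard = m := by
  have hζ := Complex.isPrimitiveRoot_exp m hm
  have hset : {ω : ℂ | ω ^ m = a} = ((Polynomial.nthRoots m a).toFinset : Set ℂ) := by
    ext ω
    simp [Polynomial.mem_nthRoots (Nat.pos_of_ne_zero hm)]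
  rw [hset, ncard_coe_finset, Multiset.toFinset_card_of_nodup (hζ.nthRoots_nodup ha),
    hζ.card_nthRoots, if_pos (IsAlgClosed.exists_pow_nat_eq a (Nat.pos_of_ne_zero hm))]

theorem unitDirections_eq_of_isRoot (hT : 0 < T.natDegree) (hroot : (T ^ 2 - 1).IsRoot z₀) :
    unitDirections T z₀ = {ω | ω ^ localDegree T z₀ = -T.eval z₀} := by
  have hm := (localDegree_pos hT z₀).ne'
  have hone : (1 : ℂ) ≠ -1 := by norm_num
  ext ω
  constructor
  · rintro ⟨⟨y, hy, h1, h2⟩, hω⟩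
    have hy1 : |y| = 1 := by simpa [hω.out] using (congrArg norm hy).symm
    rcases isRoot_sq_sub_one_iff.1 hroot with h | h
    · have : y = -1 := by grind
      simp [hy, this, h]
    · have : y = 1 := by grind
      simp [hy, this, h]
  · intro hω
    have hω' : ω ^ localDegree T z₀ = -T.eval z₀ := hω
    rcases isRoot_sq_sub_one_iff.1 hroot with h | h
    · refine ⟨⟨-1, by simp [hω', h], by simp, by simp [h, hone]⟩, ?_⟩
      exact Complex.norm_eq_one_of_pow_eq_one (n := 2 * localDegree T z₀)
        (by rw [mul_comm, pow_mul, hω', h]; norm_num) (by simp [hm])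
    · refine ⟨⟨1, by simp [hω', h], by simp [h, hone.symm], by simp⟩, ?_⟩
      exact Complex.norm_eq_one_of_pow_eq_one (n := localDegree T z₀) (by rw [hω', h]; norm_num) hm

theorem ncard_unitDirections (hT : 0 < T.natDegree) (hroot : (T ^ 2 - 1).IsRoot z₀) :
    (unitDirections T z₀).ncard = localDegree T z₀ := by
  rw [unitDirections_eq_of_isRoot hT hroot]
  refine ncard_setOf_pow_eq (localDegree_pos hT z₀).ne' (neg_ne_zero.2 ?_)
  rcases isRoot_sq_sub_one_iff.1 hroot with h | h <;> simp [h]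

end DirectionCone

section UnitSpeed

variable {γ η : ℝ → ℂ} {a b : ℝ}

theorem isAnalyticArcParam_comp_affine (hab : a < b) (hγ : AnalyticOnNhd ℝ γ (Icc a b))
    (hinj : InjOn γ (Icc a b)) (h0 : ∀ t ∈ Icc a b, deriv γ t ≠ 0) :
    IsAnalyticArcParam fun t => γ ((b - a) * t + a) := by
  have hba : 0 < b - a := sub_pos.2 hab
  have hmaps : MapsTo (fun t => (b - a) * t + a) (Icc 0 1) (Icc a b) := by
    rw [mapsTo_iff_image_subset, image_affine_Icc' hba]
    simp
  have hd : ∀ t, HasDerivAt (fun t => (b - a) * t + a) (b - a) t := fun t => by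
    simpa using ((hasDerivAt_id' t).const_mul (b - a)).add_const a
  refine ⟨fun t ht => ?_, hinj.comp (fun s _ t _ hst => ?_) hmaps, fun t ht => ?_⟩
  · exact (hγ _ (hmaps ht)).fun_comp (f := fun t => (b - a) * t + a) (by fun_prop)
  · simpa [hba.ne'] using hst
  · have hc := (hγ _ (hmaps ht)).differentiableAt.hasDerivAt.scomp t (hd t)
    rw [show deriv (fun t => γ ((b - a) * t + a)) t = _ from hc.deriv]
    exact smul_ne_zero hba.ne' (h0 _ (hmaps ht))

theorem arcTrace_comp_affine (hab : a < b) (γ : ℝ → ℂ) :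
    arcTrace (fun t => γ ((b - a) * t + a)) = γ '' Icc a b := by
  rw [arcTrace, ← image_image γ, image_affine_Icc' (sub_pos.2 hab)]
  simp

/-- `γ` is a real-analytic curve parametrised by arc length on `[a, b]`. -/
structure IsUnitSpeed (γ : ℝ → ℂ) (a b : ℝ) : Prop where
  analytic : AnalyticOnNhd ℝ γ (Icc a b)
  speed : ∀ t ∈ Icc a b, ‖deriv γ t‖ = 1

theorem IsUnitSpeed.deriv_ne_zero (hγ : IsUnitSpeed γ a b) {t : ℝ} (ht : t ∈ Icc a b) :
    deriv γ t ≠ 0 :=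
  norm_ne_zero_iff.1 (hγ.speed t ht ▸ one_ne_zero)

theorem IsAnalyticArcParam.exists_isUnitSpeed (hγ : IsAnalyticArcParam γ) {t₀ : ℝ}
    (ht₀ : t₀ ∈ Icc (0 : ℝ) 1) :
    ∃ (σ : ℝ → ℂ) (a b : ℝ), a < b ∧ 0 ∈ Icc a b ∧ IsUnitSpeed σ a b ∧
      σ '' Icc a b = arcTrace γ ∧ σ 0 = γ t₀ ∧ deriv σ 0 = ‖deriv γ t₀‖⁻¹ • deriv γ t₀ := by
  have hpos : ∀ t ∈ Icc (0 : ℝ) 1, 0 < ‖deriv γ t‖ := fun t ht => norm_pos_iff.2 (hγ.regular t ht)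
  obtain ⟨l, hmono, hlt₀, hl⟩ := exists_strictMono_hasDerivAt zero_le_one
    (fun t ht => analyticAt_norm_comp (hγ.analytic t ht).deriv (hγ.regular t ht)) hpos t₀
  have hgl : Function.LeftInverse (Function.invFun l) l :=
    Function.leftInverse_invFun hmono.injective
  have himage : l '' Icc 0 1 = Icc (l 0) (l 1) :=
    hmono.monotone.image_Icc_subset.antisymm
      (intermediate_value_Icc zero_le_one fun t ht => (hl t ht).2.continuousAt.continuousWithinAt)
  set σ := γ ∘ Function.invFun l
  have hσl : ∀ t, σ (l t) = γ t := fun t => congrArg γ (hgl t)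
  have hσ : ∀ t ∈ Icc (0 : ℝ) 1,
      AnalyticAt ℝ σ (l t) ∧ deriv σ (l t) = ‖deriv γ t‖⁻¹ • deriv γ t := fun t ht => by
    obtain ⟨g, hg, hg0, hgd, -, hr⟩ := exists_analyticAt_localInverse (hl t ht).1
      ((hl t ht).2.deriv ▸ (hpos t ht).ne')
    have hgσ : γ ∘ g =ᶠ[𝓝 (l t)] σ := hr.mono fun y hy => by
      rw [← hy, hσl, hy, Function.comp_apply]
    have hγg : AnalyticAt ℝ γ (g (l t)) := hg0.symm ▸ hγ.analytic t ht
    have hd := hγg.differentiableAt.hasDerivAt.scomp (l t) hg.differentiableAt.hasDerivAt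
    refine ⟨(hγg.comp hg).congr hgσ, ?_⟩
    rw [← hgσ.deriv_eq, hd.deriv, hg0, hgd, (hl t ht).2.deriv]
  refine ⟨σ, l 0, l 1, hmono zero_lt_one, ?_, ⟨?_, ?_⟩, ?_, ?_, ?_⟩
  · rw [← himage]
    exact ⟨t₀, ht₀, hlt₀⟩
  · rw [← himage]
    exact forall_mem_image.2 fun t ht => (hσ t ht).1
  · rw [← himage]
    refine forall_mem_image.2 fun t ht => ?_
    rw [(hσ t ht).2, norm_smul, norm_inv, norm_norm, inv_mul_cancel₀ (hpos t ht).ne']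
  · rw [← himage, image_image, arcTrace]
    exact image_congr fun t _ => hσl t
  · rw [← hlt₀, hσl]
  · rw [← hlt₀, (hσ t₀ ht₀).2]

theorem eventually_eq_of_forall_mem_Icc_eq {f g : ℝ → ℝ} (hab : a < b) {t : ℝ} (ht : t ∈ Icc a b)
    (hf : AnalyticAt ℝ f t) (hg : AnalyticAt ℝ g t) (h : ∀ s ∈ Icc a b, f s = g s) :
    ∀ᶠ s in 𝓝 t, f s = g s :=
  have hnt : (Icc a b).Nontrivial := ⟨a, left_mem_Icc.2 hab.le, b, right_mem_Icc.2 hab.le, hab.ne⟩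
  (hf.frequently_eq_iff_eventually_eq hg).1 <| (accPt_iff_frequently_nhdsNE.1 <|
    isPreconnected_Icc.preperfect_of_nontrivial hnt t ht).mono h

theorem IsUnitSpeed.eventually_norm_deriv_eq_one (hγ : IsUnitSpeed γ a b) (hab : a < b) {t : ℝ}
    (ht : t ∈ Icc a b) : ∀ᶠ s in 𝓝 t, ‖deriv γ s‖ = 1 :=
  eventually_eq_of_forall_mem_Icc_eq hab ht
    (analyticAt_norm_comp (hγ.analytic t ht).deriv (hγ.deriv_ne_zero ht)) analyticAt_const hγ.speed

end UnitSpeed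

section UniqueContinuation

variable {T : Polynomial ℂ} {z₀ : ℂ} {φ ψ : ℂ → ℂ} {γ η : ℝ → ℂ} {a b : ℝ}

theorem eventually_im_eq_zero_of_im_pow_eq_zero {m : ℕ} (hm : m ≠ 0) :
    ∀ᶠ z in 𝓝 (1 : ℂ), (z ^ m).im = 0 → z.im = 0 := by
  obtain ⟨g, -, -, -, hg, -⟩ := exists_analyticAt_localInverse (𝕜 := ℂ) (f := fun z => z ^ m)
    (a := 1) (by fun_prop) (by simpa using hm)
  have hconj : Tendsto (starRingEnd ℂ) (𝓝 1) (𝓝 1) := by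
    simpa using Complex.continuous_conj.tendsto 1
  filter_upwards [hg, hconj.eventually hg] with z hz hz' him
  rw [← Complex.conj_eq_iff_im] at him ⊢
  rw [← map_pow, him, hz] at hz'
  exact hz'.symm

namespace IsNormalForm

theorem hasDerivAt_comp (hN : IsNormalForm T z₀ φ ψ) (hγ : DifferentiableAt ℝ γ 0)
    (hz : γ 0 = z₀) : HasDerivAt (fun s => φ (γ s)) (deriv γ 0 / deriv ψ 0) 0 := by
  rw [div_eq_inv_mul, ← hN.deriv_eq]
  exact hN.analytic.differentiableAt.hasDerivAt.comp_of_eq 0 hγ.hasDerivAt hz.symm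

theorem eventually_im_pow_eq_zero (hN : IsNormalForm T z₀ φ ψ) (hγ : ContinuousAt γ 0)
    (hz : γ 0 = z₀) (him : ∀ᶠ s in 𝓝 0, (T.eval (γ s)).im = 0) :
    ∀ᶠ s in 𝓝 0, (φ (γ s) ^ localDegree T z₀).im = 0 := by
  have h0 : (T.eval z₀).im = 0 := hz ▸ him.self_of_nhds
  filter_upwards [him, (hz ▸ hγ.tendsto : Tendsto γ (𝓝 0) (𝓝 z₀)).eventually hN.eval_eq]
    with s hs he
  simpa [hs, h0] using (congrArg Complex.im he).symm

/-- The quotient `φ (γ s) / (s * w)` tends to `1` and has a real `m`-th power. -/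
theorem eventually_im_div_eq_zero (hN : IsNormalForm T z₀ φ ψ) (hT : 0 < T.natDegree)
    (hγ : DifferentiableAt ℝ γ 0) (hz : γ 0 = z₀) (h0 : deriv γ 0 ≠ 0)
    (him : ∀ᶠ s in 𝓝 0, (T.eval (γ s)).im = 0) :
    ∀ᶠ s in 𝓝 0, (φ (γ s) / (deriv γ 0 / deriv ψ 0)).im = 0 := by
  set w := deriv γ 0 / deriv ψ 0
  have hw0 : w ≠ 0 := div_ne_zero h0 hN.deriv_symm_ne
  have hreal := hN.eventually_im_pow_eq_zero hγ.continuousAt hz him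
  have hslope : Tendsto (fun s : ℝ => φ (γ s) / s) (𝓝[≠] 0) (𝓝 w) :=
    (hasDerivAt_iff_tendsto_slope.1 (hN.hasDerivAt_comp hγ hz)).congr fun s => by
      simp [slope_def_module, hz, hN.apply_base, div_eq_inv_mul]
  have hpow : (w ^ localDegree T z₀).im = 0 := by
    refine tendsto_nhds_unique
      ((Complex.continuous_im.tendsto _).comp (hslope.pow (localDegree T z₀)))
      (tendsto_const_nhds.congr' ?_)
    filter_upwards [nhdsWithin_le_nhds hreal] with s hs
    simp [div_pow, ← Complex.ofReal_pow, Complex.div_ofReal_im, hs]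
  have hone : Tendsto (fun s : ℝ => φ (γ s) / s / w) (𝓝[≠] 0) (𝓝 1) :=
    div_self hw0 ▸ hslope.div_const w
  have hpunctured : ∀ᶠ s : ℝ in 𝓝[≠] 0, (φ (γ s) / w).im = 0 := by
    filter_upwards [nhdsWithin_le_nhds hreal, self_mem_nhdsWithin, hone.eventually
      (eventually_im_eq_zero_of_im_pow_eq_zero (localDegree_pos hT z₀).ne')] with s hs hs0 h1
    rw [div_right_comm, Complex.div_ofReal_im, div_eq_zero_iff] at h1
    refine (h1 ?_).resolve_right (by simpa using hs0)
    have hwr : w ^ localDegree T z₀ = (w ^ localDegree T z₀).re := Complex.ext rfl (by simpa)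
    rw [div_pow, div_pow, hwr, ← Complex.ofReal_pow, div_right_comm, Complex.div_ofReal_im,
      Complex.div_ofReal_im, hs, zero_div, zero_div]
  filter_upwards [eventually_nhdsWithin_iff.1 hpunctured] with s hs
  rcases eq_or_ne s 0 with rfl | hs0
  · simp [hz, hN.apply_base]
  · exact hs hs0

theorem exists_real_coordinate (hN : IsNormalForm T z₀ φ ψ) (hT : 0 < T.natDegree)
    (hγ : AnalyticAt ℝ γ 0) (hz : γ 0 = z₀) (h0 : deriv γ 0 ≠ 0)
    (him : ∀ᶠ s in 𝓝 0, (T.eval (γ s)).im = 0) :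
    ∃ x : ℝ → ℝ, AnalyticAt ℝ x 0 ∧ x 0 = 0 ∧ deriv x 0 = 1 ∧
      ∀ᶠ s in 𝓝 0, γ s = ψ (deriv γ 0 / deriv ψ 0 * x s) := by
  have hline := hN.eventually_im_div_eq_zero hT hγ.differentiableAt hz h0 him
  have hd := hN.hasDerivAt_comp hγ.differentiableAt hz
  set w := deriv γ 0 / deriv ψ 0
  have hw0 : w ≠ 0 := div_ne_zero h0 hN.deriv_symm_ne
  have hφγ : AnalyticAt ℝ (fun s => φ (γ s) / w) 0 :=
    (hN.analytic.restrictScalars.comp_of_eq hγ hz).div_const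
  refine ⟨fun s => (φ (γ s) / w).re, (Complex.reCLM.analyticAt _).comp hφγ,
    by simp [hz, hN.apply_base], ?_, ?_⟩
  · have h1 := Complex.reCLM.hasFDerivAt.comp_hasDerivAt (0 : ℝ) (hd.div_const w)
    rw [show deriv (fun s => (φ (γ s) / w).re) 0 = _ from h1.deriv]
    simp [div_self hw0]
  · filter_upwards [hline, (hz ▸ hγ.continuousAt.tendsto :
      Tendsto γ (𝓝 0) (𝓝 z₀)).eventually hN.left_inv] with s hs hinv
    have hre : φ (γ s) / w = ((φ (γ s) / w).re : ℂ) := Complex.ext rfl (by simpa)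
    rw [← hre, mul_div_cancel₀ _ hw0, hinv]

theorem exists_arclength (hN : IsNormalForm T z₀ φ ψ) {w : ℂ} (hw : w ≠ 0) :
    ∃ l : ℝ → ℝ, StrictMono l ∧ ∀ x : ℝ → ℝ, AnalyticAt ℝ x 0 → x 0 = 0 →
      deriv x 0 = 1 → (∀ᶠ s in 𝓝 0, ‖deriv (fun s => ψ (w * x s)) s‖ = 1) →
        ∀ᶠ s in 𝓝 0, l (x s) = s := by
  set v : ℝ → ℝ := fun y => ‖deriv ψ (w * y) * w‖
  have hw0 : Tendsto (fun y : ℝ => w * y) (𝓝 0) (𝓝 0) := by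
    simpa using (Continuous.tendsto (by fun_prop : Continuous fun y : ℝ => w * y) 0)
  have hreg := hw0.eventually <| hN.analytic_symm.eventually_analyticAt.and
    (hN.analytic_symm.deriv.continuousAt.eventually_ne hN.deriv_symm_ne)
  obtain ⟨δ, hδ, hball⟩ := Metric.nhds_basis_closedBall.eventually_iff.1 hreg
  rw [Real.closedBall_eq_Icc] at hball
  have hv : ∀ y ∈ Icc (0 - δ) (0 + δ), AnalyticAt ℝ v y ∧ 0 < v y := fun y hy => by
    have hne := mul_ne_zero (hball hy).2 hw
    refine ⟨analyticAt_norm_comp (AnalyticAt.mul ?_ analyticAt_const) hne, norm_pos_iff.2 hne⟩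
    exact (hball hy).1.deriv.restrictScalars.fun_comp (f := fun y : ℝ => w * y)
      (analyticAt_const.mul (Complex.ofRealCLM.analyticAt y))
  obtain ⟨l, hmono, hl0, hl⟩ := exists_strictMono_hasDerivAt (by linarith)
    (fun y hy => (hv y hy).1) (fun y hy => (hv y hy).2) 0
  refine ⟨l, hmono, fun x hx hx0 hxd hspeed => ?_⟩
  have hxt : Tendsto x (𝓝 0) (𝓝 0) := by simpa [hx0] using hx.continuousAt.tendsto
  have hxpos : ∀ᶠ s in 𝓝 0, 0 < deriv x s :=
    hx.deriv.continuousAt.eventually (hxd ▸ lt_mem_nhds one_pos)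
  have hder : ∀ᶠ s in 𝓝 0, HasDerivAt (fun s => l (x s) - s) 0 s := by
    have hnear := hxt.eventually
      (Icc_mem_nhds (a := 0 - δ) (b := 0 + δ) (by linarith) (by linarith))
    filter_upwards [hnear, hxpos, hx.eventually_analyticAt, hspeed] with s hs hpos hxs hn
    have hxs' := hxs.differentiableAt.hasDerivAt
    have hψ := (hball hs).1.differentiableAt.hasDerivAt.comp s (hxs'.ofReal_comp.const_mul w)
    rw [show deriv (fun s => ψ (w * x s)) s = _ from hψ.deriv, ← mul_assoc, norm_mul,
      Complex.norm_real, Real.norm_of_nonneg hpos.le] at hn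
    have hlx := ((hl _ hs).2.comp s hxs').fun_sub (hasDerivAt_id' s)
    rwa [show v (x s) * deriv x s = 1 from hn, sub_self] at hlx
  filter_upwards [eventually_eq_const_of_hasDerivAt_zero hder] with s hs
  simpa [hx0, hl0, sub_eq_zero] using hs

end IsNormalForm

/-- Both curves are `s ↦ ψ (w * x s)` for the same `w`, and `x s` is determined by arc length. -/
theorem eventuallyEq_of_norm_deriv_eq_one (hT : 0 < T.natDegree) (hγ : AnalyticAt ℝ γ 0)
    (hη : AnalyticAt ℝ η 0) (hγs : ∀ᶠ t in 𝓝 0, ‖deriv γ t‖ = 1)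
    (hηs : ∀ᶠ t in 𝓝 0, ‖deriv η t‖ = 1) (hγT : ∀ᶠ t in 𝓝 0, (T.eval (γ t)).im = 0)
    (hηT : ∀ᶠ t in 𝓝 0, (T.eval (η t)).im = 0) (h0 : γ 0 = η 0) (hd : deriv γ 0 = deriv η 0) :
    γ =ᶠ[𝓝 0] η := by
  obtain ⟨φ, ψ, hN⟩ := exists_isNormalForm hT (γ 0)
  have hγ0 : deriv γ 0 ≠ 0 := norm_ne_zero_iff.1 (hγs.self_of_nhds ▸ one_ne_zero)
  obtain ⟨x, hx, hx0, hxd, hγx⟩ := hN.exists_real_coordinate hT hγ rfl hγ0 hγT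
  obtain ⟨y, hy, hy0, hyd, hηy⟩ := hN.exists_real_coordinate hT hη h0.symm (hd ▸ hγ0) hηT
  rw [← hd] at hηy
  obtain ⟨l, hmono, hl⟩ := hN.exists_arclength (div_ne_zero hγ0 hN.deriv_symm_ne)
  have hlx := hl x hx hx0 hxd (by
    filter_upwards [hγs, hγx.eventually_nhds] with s hs he
    rwa [← EventuallyEq.deriv_eq he])
  have hly := hl y hy hy0 hyd (by
    filter_upwards [hηs, hηy.eventually_nhds] with s hs he
    rwa [← EventuallyEq.deriv_eq he])
  filter_upwards [hγx, hηy, hlx, hly] with s hγs hηs hxs hys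
  rw [hγs, hηs, hmono.injective (hxs.trans hys.symm)]

end UniqueContinuation

section Gluing

variable {T : Polynomial ℂ} {γ₁ γ₂ : ℝ → ℂ} {a₁ b₁ a₂ b₂ : ℝ}

theorem IsUnitSpeed.isAnalyticJordanArc (hT : 0 < T.natDegree) (hab : a₁ < b₁)
    (h : IsUnitSpeed γ₁ a₁ b₁) (him : ∀ s ∈ Icc a₁ b₁, (T.eval (γ₁ s)).im = 0) :
    IsAnalyticJordanArc (γ₁ '' Icc a₁ b₁) :=
  have h0 : ∀ t ∈ Icc a₁ b₁, deriv γ₁ t ≠ 0 := fun _ => h.deriv_ne_zero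
  ⟨_, isAnalyticArcParam_comp_affine hab h.analytic
    (injOn_of_im_eval_eq_zero hT h.analytic h0 him) h0, arcTrace_comp_affine hab γ₁⟩

theorem eventually_im_eval_eq_zero (hab : a₁ < b₁) {t : ℝ} (ht : t ∈ Icc a₁ b₁)
    (hγ : AnalyticAt ℝ γ₁ t) (him : ∀ s ∈ Icc a₁ b₁, (T.eval (γ₁ s)).im = 0) :
    ∀ᶠ s in 𝓝 t, (T.eval (γ₁ s)).im = 0 :=
  eventually_eq_of_forall_mem_Icc_eq hab ht ((Complex.imCLM.analyticAt _).comp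
    ((T.differentiable.analyticAt (γ₁ t)).restrictScalars.comp hγ)) analyticAt_const him

theorem exists_common_extension {E : Type*} [NormedAddCommGroup E] [NormedSpace ℝ E]
    [CompleteSpace E] {f₁ f₂ : ℝ → E} (h₁ : AnalyticOnNhd ℝ f₁ (Icc a₁ b₁))
    (h₂ : AnalyticOnNhd ℝ f₂ (Icc a₂ b₂)) {t₀ : ℝ}
    (ht₁ : t₀ ∈ Icc a₁ b₁) (ht₂ : t₀ ∈ Icc a₂ b₂) (heq : f₁ =ᶠ[𝓝 t₀] f₂) :
    ∃ f : ℝ → E, (∀ t ∈ Icc a₁ b₁, f =ᶠ[𝓝 t] f₁) ∧ ∀ t ∈ Icc a₂ b₂, f =ᶠ[𝓝 t] f₂ := by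
  obtain ⟨δ₁, hδ₁, hU₁⟩ := exists_Icc_subset_of_isOpen (ht₁.1.trans ht₁.2)
    (isOpen_analyticAt ℝ f₁) h₁
  obtain ⟨δ₂, hδ₂, hU₂⟩ := exists_Icc_subset_of_isOpen (ht₂.1.trans ht₂.2)
    (isOpen_analyticAt ℝ f₂) h₂
  set I₁ := Ioo (a₁ - δ₁) (b₁ + δ₁)
  set I₂ := Ioo (a₂ - δ₂) (b₂ + δ₂)
  have hsub₁ : Icc a₁ b₁ ⊆ I₁ := Icc_subset_Ioo (by linarith) (by linarith)
  have hsub₂ : Icc a₂ b₂ ⊆ I₂ := Icc_subset_Ioo (by linarith) (by linarith)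
  have heqOn : EqOn f₁ f₂ (I₁ ∩ I₂) :=
    AnalyticOnNhd.eqOn_of_preconnected_of_eventuallyEq (𝕜 := ℝ)
      (fun t ht => hU₁ (Ioo_subset_Icc_self ht.1)) (fun t ht => hU₂ (Ioo_subset_Icc_self ht.2))
      (ordConnected_Ioo.inter ordConnected_Ioo).isPreconnected ⟨hsub₁ ht₁, hsub₂ ht₂⟩ heq
  classical
  refine ⟨I₁.piecewise f₁ f₂, fun t ht => ?_, fun t ht => ?_⟩
  · exact (piecewise_eqOn _ _ _).eventuallyEq_of_mem (isOpen_Ioo.mem_nhds (hsub₁ ht))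
  · filter_upwards [isOpen_Ioo.mem_nhds (hsub₂ ht)] with s hs
    by_cases h : s ∈ I₁
    · rw [piecewise_eq_of_mem _ _ _ h, heqOn ⟨h, hs⟩]
    · exact piecewise_eq_of_notMem _ _ _ h

theorem IsUnitSpeed.isAnalyticJordanArc_union (hT : 0 < T.natDegree)
    (h₁ : IsUnitSpeed γ₁ a₁ b₁) (h₂ : IsUnitSpeed γ₂ a₂ b₂) (hab₁ : a₁ < b₁) (hab₂ : a₂ < b₂)
    (h0₁ : 0 ∈ Icc a₁ b₁) (h0₂ : 0 ∈ Icc a₂ b₂)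
    (him₁ : ∀ s ∈ Icc a₁ b₁, (T.eval (γ₁ s)).im = 0)
    (him₂ : ∀ s ∈ Icc a₂ b₂, (T.eval (γ₂ s)).im = 0)
    (h0 : γ₁ 0 = γ₂ 0) (hd : deriv γ₁ 0 = deriv γ₂ 0) :
    IsAnalyticJordanArc (γ₁ '' Icc a₁ b₁ ∪ γ₂ '' Icc a₂ b₂) := by
  have hgerm := eventuallyEq_of_norm_deriv_eq_one hT (h₁.analytic 0 h0₁) (h₂.analytic 0 h0₂)
    (h₁.eventually_norm_deriv_eq_one hab₁ h0₁) (h₂.eventually_norm_deriv_eq_one hab₂ h0₂)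
    (eventually_im_eval_eq_zero hab₁ h0₁ (h₁.analytic 0 h0₁) him₁)
    (eventually_im_eval_eq_zero hab₂ h0₂ (h₂.analytic 0 h0₂) him₂) h0 hd
  obtain ⟨γ, hγ₁, hγ₂⟩ := exists_common_extension h₁.analytic h₂.analytic h0₁ h0₂ hgerm
  have hunion : Icc (min a₁ a₂) (max b₁ b₂) = Icc a₁ b₁ ∪ Icc a₂ b₂ :=
    (Icc_union_Icc' (h0₂.1.trans h0₁.2) (h0₁.1.trans h0₂.2)).symm
  have hγ : IsUnitSpeed γ (min a₁ a₂) (max b₁ b₂) := by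
    constructor <;> rw [hunion] <;> rintro t (ht | ht)
    · exact (h₁.analytic t ht).congr (hγ₁ t ht).symm
    · exact (h₂.analytic t ht).congr (hγ₂ t ht).symm
    · rw [(hγ₁ t ht).deriv_eq, h₁.speed t ht]
    · rw [(hγ₂ t ht).deriv_eq, h₂.speed t ht]
  have harc := hγ.isAnalyticJordanArc hT (inf_le_left.trans_lt (hab₁.trans_le le_sup_left)) <| by
    rw [hunion]
    rintro t (ht | ht)
    · rw [(hγ₁ t ht).self_of_nhds, him₁ t ht]
    · rw [(hγ₂ t ht).self_of_nhds, him₂ t ht]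
  rwa [hunion, image_union, image_congr fun t ht => (hγ₁ t ht).self_of_nhds,
    image_congr fun t ht => (hγ₂ t ht).self_of_nhds] at harc

/-- The parametrised arc `γ`, traversed starting from `γ 0` or, for `e = true`, from `γ 1`. -/
def fromEnd (γ : ℝ → ℂ) (e : Bool) : ℝ → ℂ := bif e then fun t => γ (1 - t) else γ

theorem arcTrace_fromEnd (γ : ℝ → ℂ) (e : Bool) : arcTrace (fromEnd γ e) = arcTrace γ := by
  cases e
  · rfl
  · rw [arcTrace, fromEnd, cond_true, ← image_image γ, image_const_sub_Icc, sub_self, sub_zero,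
      arcTrace]

theorem hasDerivAt_fromEnd_true {γ : ℝ → ℂ} {t : ℝ} (hγ : DifferentiableAt ℝ γ t) :
    HasDerivAt (fromEnd γ true) (-deriv γ t) (1 - t) := by
  have hcomp := hγ.hasDerivAt.scomp_of_eq (1 - t) ((hasDerivAt_id' (1 - t)).const_sub 1)
    (sub_sub_cancel 1 t).symm
  rwa [neg_one_smul] at hcomp

theorem isAnalyticArcParam_fromEnd {γ : ℝ → ℂ} (hγ : IsAnalyticArcParam γ) (e : Bool) :
    IsAnalyticArcParam (fromEnd γ e) := by
  cases e with
  | false => exact hγ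
  | true =>
    have hmaps : ∀ t ∈ Icc (0 : ℝ) 1, 1 - t ∈ Icc (0 : ℝ) 1 := fun t ht => Icc.one_sub_mem ht
    refine ⟨fun t ht => ?_, fun s hs t ht hst => ?_, fun t ht => ?_⟩
    · exact (hγ.analytic _ (hmaps t ht)).fun_comp (f := fun t => 1 - t) (by fun_prop)
    · exact sub_right_injective (hγ.injective (hmaps s hs) (hmaps t ht) hst)
    · have hd := hasDerivAt_fromEnd_true (hγ.analytic _ (hmaps t ht)).differentiableAt
      rw [sub_sub_cancel] at hd
      rw [hd.deriv]
      exact neg_ne_zero.2 (hγ.regular _ (hmaps t ht))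

theorem isAnalyticJordanArc_union_of_pos (hT : 0 < T.natDegree) (h₁ : IsAnalyticArcParam γ₁)
    (h₂ : IsAnalyticArcParam γ₂) (him : ∀ z ∈ arcTrace γ₁ ∪ arcTrace γ₂, (T.eval z).im = 0)
    {t₁ t₂ : ℝ} (ht₁ : t₁ ∈ Icc (0 : ℝ) 1) (ht₂ : t₂ ∈ Icc (0 : ℝ) 1) (he : γ₁ t₁ = γ₂ t₂)
    {c : ℝ} (hc : 0 < c) (hd : deriv γ₂ t₂ = c * deriv γ₁ t₁) :
    IsAnalyticJordanArc (arcTrace γ₁ ∪ arcTrace γ₂) := by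
  obtain ⟨σ₁, a₁, b₁, hab₁, h0₁, hσ₁, htr₁, hσ0₁, hd₁⟩ := h₁.exists_isUnitSpeed ht₁
  obtain ⟨σ₂, a₂, b₂, hab₂, h0₂, hσ₂, htr₂, hσ0₂, hd₂⟩ := h₂.exists_isUnitSpeed ht₂
  rw [← htr₁, ← htr₂] at him ⊢
  refine hσ₁.isAnalyticJordanArc_union hT hσ₂ hab₁ hab₂ h0₁ h0₂
    (fun s hs => him _ (.inl ⟨s, hs, rfl⟩)) (fun s hs => him _ (.inr ⟨s, hs, rfl⟩))
    (by rw [hσ0₁, hσ0₂, he]) ?_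
  have hc' : (c : ℂ) ≠ 0 := by exact_mod_cast hc.ne'
  rw [hd₁, hd₂, hd, norm_mul, Complex.norm_real, Real.norm_of_nonneg hc.le]
  simp only [Complex.real_smul, mul_inv, Complex.ofReal_mul, Complex.ofReal_inv]
  field_simp

theorem isAnalyticJordanArc_union (hT : 0 < T.natDegree) (h₁ : IsAnalyticArcParam γ₁)
    (h₂ : IsAnalyticArcParam γ₂) (him : ∀ z ∈ arcTrace γ₁ ∪ arcTrace γ₂, (T.eval z).im = 0)
    {t₁ t₂ : ℝ} (ht₁ : t₁ ∈ Icc (0 : ℝ) 1) (ht₂ : t₂ ∈ Icc (0 : ℝ) 1) (he : γ₁ t₁ = γ₂ t₂)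
    {c : ℝ} (hd : deriv γ₂ t₂ = c * deriv γ₁ t₁) :
    IsAnalyticJordanArc (arcTrace γ₁ ∪ arcTrace γ₂) := by
  rcases lt_trichotomy c 0 with hc | rfl | hc
  · rw [← arcTrace_fromEnd γ₂ true] at him ⊢
    have hdiff := (h₂.analytic t₂ ht₂).differentiableAt
    refine isAnalyticJordanArc_union_of_pos hT h₁ (isAnalyticArcParam_fromEnd h₂ true) him ht₁
      (Icc.one_sub_mem ht₂) ?_ (neg_pos.2 hc) ?_
    · simp [fromEnd, he]
    · rw [(hasDerivAt_fromEnd_true hdiff).deriv, hd]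
      simp
  · exact absurd (by simpa using hd) (h₂.regular t₂ ht₂)
  · exact isAnalyticJordanArc_union_of_pos hT h₁ h₂ him ht₁ ht₂ he hc hd

end Gluing

section ArcCoordinate

variable {γ η : ℝ → ℂ}

/-- The parameter of a point of the arc `γ`; a junk value at points off the arc. -/
noncomputable def arcCoord (γ : ℝ → ℂ) : ℂ → ℝ := Function.invFunOn γ (Icc 0 1)

theorem arcCoord_mem {z : ℂ} (hz : z ∈ arcTrace γ) : arcCoord γ z ∈ Icc (0 : ℝ) 1 :=
  Function.invFunOn_mem hz

theorem apply_arcCoord {z : ℂ} (hz : z ∈ arcTrace γ) : γ (arcCoord γ z) = z :=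
  Function.invFunOn_eq hz

theorem IsAnalyticArcParam.arcCoord_apply (hγ : IsAnalyticArcParam γ) {t : ℝ}
    (ht : t ∈ Icc (0 : ℝ) 1) : arcCoord γ (γ t) = t :=
  have hz : γ t ∈ arcTrace γ := mem_image_of_mem γ ht
  hγ.injective (arcCoord_mem hz) ht (apply_arcCoord hz)

theorem IsAnalyticArcParam.isCompact_arcTrace (hγ : IsAnalyticArcParam γ) :
    IsCompact (arcTrace γ) :=
  isCompact_Icc.image_of_continuousOn hγ.analytic.continuousOn

theorem IsAnalyticArcParam.continuousOn_arcCoord (hγ : IsAnalyticArcParam γ) :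
    ContinuousOn (arcCoord γ) (arcTrace γ) := by
  refine continuousOn_iff_isClosed.2 fun A hA => ⟨γ '' (Icc 0 1 ∩ A), ?_, ?_⟩
  · exact ((isCompact_Icc.inter_right hA).image_of_continuousOn
      (hγ.analytic.continuousOn.mono inter_subset_left)).isClosed
  · ext z
    constructor
    · rintro ⟨hzA, hz⟩
      exact ⟨⟨_, ⟨arcCoord_mem hz, hzA⟩, apply_arcCoord hz⟩, hz⟩
    · rintro ⟨⟨t, ht, rfl⟩, hz⟩
      exact ⟨by rw [mem_preimage, hγ.arcCoord_apply ht.1]; exact ht.2, hz⟩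

theorem IsAnalyticArcParam.tendsto_sub_div_arcCoord_sub (hγ : IsAnalyticArcParam γ) {α : Type*}
    {F : Filter α} {c : α → ℂ} {t : ℝ} (ht : t ∈ Icc (0 : ℝ) 1) (hc : Tendsto c F (𝓝 (γ t)))
    (hne : ∀ᶠ a in F, c a ≠ γ t) (hmem : ∀ᶠ a in F, c a ∈ arcTrace γ) :
    Tendsto (fun a => (c a - γ t) / (arcCoord γ (c a) - t : ℝ)) F (𝓝 (deriv γ t)) := by
  have hcoord : Tendsto (fun a => arcCoord γ (c a)) F (𝓝[≠] t) := by
    refine tendsto_nhdsWithin_iff.2 ⟨?_, ?_⟩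
    · have hcont := hγ.continuousOn_arcCoord (γ t) (mem_image_of_mem γ ht)
      rw [ContinuousWithinAt, hγ.arcCoord_apply ht] at hcont
      exact hcont.comp (tendsto_nhdsWithin_iff.2 ⟨hc, hmem⟩)
    · filter_upwards [hne, hmem] with a hat ha heq
      exact hat (by rw [← mem_singleton_iff.1 heq, apply_arcCoord ha])
  refine ((hasDerivAt_iff_tendsto_slope.1 (hγ.analytic t ht).differentiableAt.hasDerivAt).comp
    hcoord).congr' (hmem.mono fun a ha => ?_)
  rw [Function.comp_apply, slope_def_module, apply_arcCoord ha, Complex.real_smul,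
    Complex.ofReal_inv, inv_mul_eq_div]

theorem exists_real_mul_eq_of_tendsto_div {α : Type*} {F : Filter α} [F.NeBot] {f : α → ℂ}
    {p q : α → ℝ} {v w : ℂ} (hv : v ≠ 0) (hp : Tendsto (fun a => f a / p a) F (𝓝 v))
    (hq : Tendsto (fun a => f a / q a) F (𝓝 w)) :
    ∃ ρ : ℝ, w = ρ * v ∧ Tendsto (fun a => p a / q a) F (𝓝 ρ) := by
  have hlim : Tendsto (fun a => ((p a / q a : ℝ) : ℂ)) F (𝓝 (w / v)) := by
    refine (hq.div hp hv).congr' ((hp.eventually_ne hv).mono fun a ha => ?_)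
    obtain ⟨hf, hpa⟩ := div_ne_zero_iff.1 ha
    simp only [Pi.div_apply, Complex.ofReal_div]
    field_simp
  obtain ⟨ρ, hρ⟩ := Complex.isometry_ofReal.isClosedEmbedding.isClosed_range.mem_of_tendsto hlim
    (.of_forall fun a => mem_range_self (p a / q a))
  rw [← hρ] at hlim
  exact ⟨ρ, (div_eq_iff hv).1 hρ.symm,
    Complex.isometry_ofReal.isClosedEmbedding.isEmbedding.tendsto_nhds_iff.2 hlim⟩

theorem IsAnalyticArcParam.exists_tangent (hγ : IsAnalyticArcParam γ) {c : ℝ → ℂ} {w : ℂ}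
    (hw : w ≠ 0) (hc : HasDerivWithinAt c w (Ioi 0) 0)
    (hmem : ∃ᶠ s in 𝓝[>] 0, c s ∈ arcTrace γ) :
    ∃ t ∈ Icc (0 : ℝ) 1, γ t = c 0 ∧
      ∃ ρ : ℝ, w = ρ * deriv γ t ∧ (t = 0 → 0 < ρ) ∧ (t = 1 → ρ < 0) := by
  set F := 𝓝[>] (0 : ℝ) ⊓ 𝓟 {s | c s ∈ arcTrace γ}
  have : F.NeBot := frequently_mem_iff_neBot.1 hmem
  have hF : F ≤ 𝓝[>] 0 := inf_le_left
  have hFmem : ∀ᶠ s in F, c s ∈ arcTrace γ := mem_inf_of_right (mem_principal_self _)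
  have hFpos : ∀ᶠ s in F, 0 < s := hF self_mem_nhdsWithin
  have hcF : Tendsto c F (𝓝 (c 0)) := hc.continuousWithinAt.tendsto.mono_left hF
  obtain ⟨t, ht, htc⟩ := hγ.isCompact_arcTrace.isClosed.mem_of_tendsto hcF hFmem
  rw [← htc] at hcF
  have hslope : Tendsto (fun s => (c s - γ t) / (s : ℝ)) F (𝓝 w) := by
    refine (((hasDerivWithinAt_iff_tendsto_slope' self_notMem_Ioi).1 hc).mono_left hF).congr
      fun s => ?_
    rw [slope_def_module, sub_zero, Complex.real_smul, Complex.ofReal_inv, inv_mul_eq_div, htc]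
  have hne : ∀ᶠ s in F, c s ≠ γ t := (hslope.eventually_ne hw).mono fun s hs heq => hs (by
    rw [heq, sub_self, zero_div])
  obtain ⟨ρ, hρ, hlim⟩ := exists_real_mul_eq_of_tendsto_div (hγ.regular t ht)
    (hγ.tendsto_sub_div_arcCoord_sub ht hcF hne hFmem) hslope
  have hρ0 : ρ ≠ 0 := fun h => hw (by rw [hρ, h, Complex.ofReal_zero, zero_mul])
  refine ⟨t, ht, htc, ρ, hρ, fun h => lt_of_le_of_ne ?_ hρ0.symm, fun h => lt_of_le_of_ne ?_ hρ0⟩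
  · refine ge_of_tendsto hlim ?_
    filter_upwards [hFmem, hFpos] with s hs hs0
    exact div_nonneg (by linarith [(arcCoord_mem hs).1]) hs0.le
  · refine le_of_tendsto hlim ?_
    filter_upwards [hFmem, hFpos] with s hs hs0
    exact div_nonpos_of_nonpos_of_nonneg (by linarith [(arcCoord_mem hs).2]) hs0.le

theorem exists_parallel_of_infinite_inter (hγ : IsAnalyticArcParam γ) (hη : IsAnalyticArcParam η)
    (hinf : (arcTrace γ ∩ arcTrace η).Infinite) :
    ∃ s ∈ Icc (0 : ℝ) 1, ∃ t ∈ Icc (0 : ℝ) 1, γ s = η t ∧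
      ∃ ρ : ℝ, deriv η t = ρ * deriv γ s := by
  obtain ⟨z₀, ⟨⟨s, hs, rfl⟩, ⟨t, ht, hts⟩⟩, hacc⟩ :=
    hinf.exists_accPt_of_subset_isCompact (hγ.isCompact_arcTrace.inter hη.isCompact_arcTrace)
      Subset.rfl
  have : (𝓝[≠] (γ s) ⊓ 𝓟 (arcTrace γ ∩ arcTrace η)).NeBot := hacc
  set F := 𝓝[≠] (γ s) ⊓ 𝓟 (arcTrace γ ∩ arcTrace η)
  have hid : Tendsto id F (𝓝 (γ s)) := tendsto_id'.2 (inf_le_left.trans inf_le_left)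
  have hne : ∀ᶠ z in F, id z ≠ γ s := mem_inf_of_left self_mem_nhdsWithin
  have hmem : ∀ᶠ z in F, z ∈ arcTrace γ ∩ arcTrace η := mem_inf_of_right (mem_principal_self _)
  have hslopeγ := hγ.tendsto_sub_div_arcCoord_sub hs hid hne (hmem.mono fun z hz => hz.1)
  rw [← hts] at hid hne hslopeγ
  obtain ⟨ρ, hρ, -⟩ := exists_real_mul_eq_of_tendsto_div (hγ.regular s hs) hslopeγ
    (hη.tendsto_sub_div_arcCoord_sub ht hid hne (hmem.mono fun z hz => hz.2))
  exact ⟨s, hs, t, ht, hts.symm, ρ, hρ⟩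

theorem IsAnalyticArcParam.exists_image_Icc_eq (hγ : IsAnalyticArcParam γ)
    (hη : IsAnalyticArcParam η) (hsub : arcTrace η ⊆ arcTrace γ) :
    ∃ a b, 0 ≤ a ∧ a < b ∧ b ≤ 1 ∧ γ '' Icc a b = arcTrace η ∧
      (γ a = η 0 ∧ γ b = η 1 ∨ γ a = η 1 ∧ γ b = η 0) := by
  set P : ℝ → ℝ := fun t => arcCoord γ (η t)
  have hηγ : MapsTo η (Icc 0 1) (arcTrace γ) := fun t ht => hsub (mem_image_of_mem η ht)
  have hPc : ContinuousOn P (Icc 0 1) :=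
    hγ.continuousOn_arcCoord.comp hη.analytic.continuousOn hηγ
  have hPmem : ∀ t ∈ Icc (0 : ℝ) 1, P t ∈ Icc (0 : ℝ) 1 := fun t ht => arcCoord_mem (hηγ ht)
  have hγP : ∀ t ∈ Icc (0 : ℝ) 1, γ (P t) = η t := fun t ht => apply_arcCoord (hηγ ht)
  have hPinj : InjOn P (Icc 0 1) := fun s hs t ht hst =>
    hη.injective hs ht (by rw [← hγP s hs, ← hγP t ht, hst])
  have himage : γ '' (P '' Icc 0 1) = arcTrace η := by
    rw [image_image]
    exact image_congr hγP
  have h0 : (0 : ℝ) ∈ Icc (0 : ℝ) 1 := left_mem_Icc.2 zero_le_one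
  have h1 : (1 : ℝ) ∈ Icc (0 : ℝ) 1 := right_mem_Icc.2 zero_le_one
  rcases hPc.strictMonoOn_of_injOn_Icc' zero_le_one hPinj with hmono | hanti
  · refine ⟨P 0, P 1, (hPmem 0 h0).1, hmono h0 h1 zero_lt_one, (hPmem 1 h1).2, ?_,
      .inl ⟨hγP 0 h0, hγP 1 h1⟩⟩
    rw [← himage, hmono.monotoneOn.image_Icc_subset.antisymm
      (intermediate_value_Icc zero_le_one hPc)]
  · refine ⟨P 1, P 0, (hPmem 1 h1).1, hanti h0 h1 zero_lt_one, (hPmem 0 h0).2, ?_,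
      .inr ⟨hγP 1 h1, hγP 0 h0⟩⟩
    rw [← himage, hanti.antitoneOn.image_Icc_subset.antisymm
      (intermediate_value_Icc' zero_le_one hPc)]

theorem eq_of_ordConnected_Icc_union_Icc {a₁ b₁ a₂ b₂ : ℝ} (hab₁ : a₁ < b₁) (hab₂ : a₂ < b₂)
    (ha : a₁ ≤ a₂) (hconn : (Icc a₁ b₁ ∪ Icc a₂ b₂).OrdConnected)
    (hfin : (Icc a₁ b₁ ∩ Icc a₂ b₂).Finite) : b₁ = a₂ := by
  refine le_antisymm ?_ ?_
  · by_contra! hlt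
    rw [Icc_inter_Icc] at hfin
    exact Icc_infinite (max_lt (lt_min hab₁ (ha.trans_lt hab₂)) (lt_min hlt hab₂)) hfin
  · by_contra! hlt
    have hmid : (b₁ + a₂) / 2 ∈ Icc a₁ b₁ ∪ Icc a₂ b₂ :=
      hconn.out (.inl (right_mem_Icc.2 hab₁.le)) (.inr (left_mem_Icc.2 hab₂.le))
        ⟨by linarith, by linarith⟩
    rcases hmid with hmid | hmid
    · linarith [hmid.2]
    · linarith [hmid.1]

theorem exists_inter_eq_singleton_of_union_eq {γ₁ γ₂ : ℝ → ℂ} (hγ : IsAnalyticArcParam γ)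
    (h₁ : IsAnalyticArcParam γ₁) (h₂ : IsAnalyticArcParam γ₂)
    (hfin : (arcTrace γ₁ ∩ arcTrace γ₂).Finite) (hu : arcTrace γ = arcTrace γ₁ ∪ arcTrace γ₂) :
    ∃ s ∈ Ioo (0 : ℝ) 1, arcTrace γ₁ ∩ arcTrace γ₂ = {γ s} ∧
      (γ s = γ₁ 0 ∨ γ s = γ₁ 1) ∧ (γ s = γ₂ 0 ∨ γ s = γ₂ 1) := by
  obtain ⟨a₁, b₁, ha₁, hab₁, hb₁, htr₁, hend₁⟩ :=
    hγ.exists_image_Icc_eq h₁ (hu ▸ subset_union_left)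
  obtain ⟨a₂, b₂, ha₂, hab₂, hb₂, htr₂, hend₂⟩ :=
    hγ.exists_image_Icc_eq h₂ (hu ▸ subset_union_right)
  wlog ha : a₁ ≤ a₂ generalizing γ₁ γ₂ a₁ b₁ a₂ b₂
  · rw [inter_comm] at hfin ⊢
    rw [union_comm] at hu
    obtain ⟨s, hs, hinter, hs₁, hs₂⟩ := this h₂ h₁ hfin hu a₂ b₂ ha₂ hab₂ hb₂ htr₂ hend₂
      a₁ b₁ ha₁ hab₁ hb₁ htr₁ hend₁ (le_of_not_ge ha)
    exact ⟨s, hs, hinter, hs₂, hs₁⟩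
  have hI₁ : Icc a₁ b₁ ⊆ Icc 0 1 := Icc_subset_Icc ha₁ hb₁
  have hI₂ : Icc a₂ b₂ ⊆ Icc 0 1 := Icc_subset_Icc ha₂ hb₂
  have hunion : Icc a₁ b₁ ∪ Icc a₂ b₂ = Icc 0 1 :=
    (hγ.injective.image_eq_image_iff (union_subset hI₁ hI₂) Subset.rfl).1 <| by
      rw [image_union, htr₁, htr₂, ← hu, arcTrace]
  have hinter : γ '' (Icc a₁ b₁ ∩ Icc a₂ b₂) = arcTrace γ₁ ∩ arcTrace γ₂ := by
    rw [hγ.injective.image_inter hI₁ hI₂, htr₁, htr₂]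
  rw [← hinter] at hfin ⊢
  obtain rfl : b₁ = a₂ := eq_of_ordConnected_Icc_union_Icc hab₁ hab₂ ha (hunion ▸ ordConnected_Icc)
    (hfin.of_finite_image (hγ.injective.mono (inter_subset_left.trans hI₁)))
  refine ⟨b₁, ⟨ha₁.trans_lt hab₁, hab₂.trans_le hb₂⟩, ?_, ?_, ?_⟩
  · rw [Icc_inter_Icc_eq_singleton hab₁.le hab₂.le, image_singleton]
  · exact hend₁.symm.imp And.right And.right
  · exact hend₂.imp And.left And.left

end ArcCoordinate

section Ends

variable {T : Polynomial ℂ} {z₀ : ℂ} {φ ψ : ℂ → ℂ} {γ η : ℝ → ℂ}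

/-- The unit direction in which the arc `η` leaves `η 0`, in a coordinate in which tangent vectors
are divided by `κ`; for a normal form, `κ = deriv ψ 0`. -/
noncomputable def outDirection (κ : ℂ) (η : ℝ → ℂ) : ℂ := NormedSpace.normalize (deriv η 0 / κ)

theorem IsAnalyticArcParam.outDirection_mem_unitDirections (hη : IsAnalyticArcParam η)
    (hN : IsNormalForm T z₀ φ ψ) (hT : 0 < T.natDegree) (hηS : arcTrace η ⊆ inverseImage T)
    (h0 : η 0 = z₀) : outDirection (deriv ψ 0) η ∈ unitDirections T z₀ := by
  have hmem0 : (0 : ℝ) ∈ Icc (0 : ℝ) 1 := left_mem_Icc.2 zero_le_one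
  have hcone : deriv η 0 / deriv ψ 0 ∈ directionCone T z₀ := by
    refine hN.div_deriv_mem_directionCone hT (h0 ▸ hηS (mem_image_of_mem η hmem0))
      (hη.analytic 0 hmem0).differentiableAt.hasDerivAt.hasDerivWithinAt h0 ?_
    refine Eventually.frequently ?_
    filter_upwards [Ioo_mem_nhdsGT zero_lt_one] with s hs
    exact hηS (mem_image_of_mem η (Ioo_subset_Icc_self hs))
  refine ⟨?_, NormedSpace.norm_normalize_eq_one_iff.2
    (div_ne_zero (hη.regular 0 hmem0) hN.deriv_symm_ne)⟩
  rw [outDirection, NormedSpace.normalize, Complex.real_smul]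
  exact ofReal_mul_mem_directionCone hcone (inv_nonneg.2 (norm_nonneg _))

theorem outDirection_eq_of_pos {κ ω : ℂ} (hκ : κ ≠ 0) (hω : ‖ω‖ = 1) {ρ : ℝ} (hρ : 0 < ρ)
    (h : κ * ω = ρ * deriv η 0) : outDirection κ η = ω := by
  have hω' : ω = ρ • (deriv η 0 / κ) := by
    rw [Complex.real_smul, ← mul_div_assoc, ← h, mul_div_cancel_left₀ ω hκ]
  rw [← NormedSpace.normalize_eq_self_of_norm_eq_one hω, hω',
    NormedSpace.normalize_smul_of_pos hρ, outDirection]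

theorem norm_mul_mul_outDirection {κ : ℂ} (hκ : κ ≠ 0) (η : ℝ → ℂ) :
    ‖deriv η 0 / κ‖ * (κ * outDirection κ η) = deriv η 0 := by
  rw [mul_left_comm, ← Complex.real_smul, outDirection, NormedSpace.norm_smul_normalize,
    mul_div_cancel₀ _ hκ]

theorem exists_deriv_eq_mul_of_outDirection_eq {κ : ℂ} (hκ : κ ≠ 0)
    (h : outDirection κ γ = outDirection κ η) : ∃ ρ : ℝ, deriv η 0 = ρ * deriv γ 0 := by
  refine ⟨‖deriv η 0 / κ‖ * ‖deriv γ 0 / κ‖⁻¹, ?_⟩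
  calc deriv η 0 = ‖deriv η 0 / κ‖ * (κ * outDirection κ γ) := by
        rw [h, norm_mul_mul_outDirection hκ]
    _ = _ := by
        rw [outDirection, NormedSpace.normalize, Complex.real_smul, mul_left_comm κ,
          mul_div_cancel₀ _ hκ, Complex.ofReal_mul, mul_assoc]

theorem IsAnalyticArcParam.exists_fromEnd_of_tangent (hγ : IsAnalyticArcParam γ) {c : ℝ → ℂ}
    {w : ℂ} (hw : w ≠ 0) (hc : HasDerivWithinAt c w (Ioi 0) 0)
    (hmem : ∃ᶠ s in 𝓝[>] 0, c s ∈ arcTrace γ) (hint : ∀ t ∈ Ioo (0 : ℝ) 1, γ t ≠ c 0) :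
    ∃ e, fromEnd γ e 0 = c 0 ∧ ∃ ρ : ℝ, 0 < ρ ∧ w = ρ * deriv (fromEnd γ e) 0 := by
  obtain ⟨t, ht, htc, ρ, hρ, hρ0, hρ1⟩ := hγ.exists_tangent hw hc hmem
  rcases eq_endpoints_or_mem_Ioo_of_mem_Icc ht with rfl | rfl | ht'
  · exact ⟨false, htc, ρ, hρ0 rfl, hρ⟩
  · have hd := hasDerivAt_fromEnd_true (hγ.analytic 1 ht).differentiableAt
    rw [sub_self] at hd
    refine ⟨true, by simpa [fromEnd] using htc, -ρ, neg_pos.2 (hρ1 rfl), ?_⟩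
    rw [hd.deriv, hρ, Complex.ofReal_neg, neg_mul_neg]
  · exact (hint t ht' htc).elim

theorem IsNormalForm.eventually_symm_mul_mem (hN : IsNormalForm T z₀ φ ψ) (hT : 0 < T.natDegree)
    (hz₀ : z₀ ∈ inverseImage T) {w : ℂ} (hw : w ∈ directionCone T z₀) :
    ∀ᶠ s : ℝ in 𝓝[>] 0, ψ (s * w) ∈ inverseImage T := by
  have hlim : Tendsto (fun s : ℝ => (s : ℂ) * w) (𝓝[>] 0) (𝓝 0) :=
    (Continuous.tendsto' (by fun_prop) 0 0 (by simp)).mono_left nhdsWithin_le_nhds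
  filter_upwards [hlim.eventually (hN.eventually_symm_mem_inverseImage_iff hT hz₀),
    self_mem_nhdsWithin] with s hs hpos
  exact hs.2 (ofReal_mul_mem_directionCone hw (le_of_lt hpos))

theorem IsNormalForm.hasDerivAt_symm_mul (hN : IsNormalForm T z₀ φ ψ) (w : ℂ) :
    HasDerivAt (fun s : ℝ => ψ (s * w)) (deriv ψ 0 * w) 0 := by
  have hline : HasDerivAt (fun s : ℝ => (s : ℂ) * w) w 0 := by
    simpa using (hasDerivAt_id' (0 : ℝ)).ofReal_comp.mul_const w
  exact hN.analytic_symm.differentiableAt.hasDerivAt.comp_of_eq 0 hline (by simp)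

theorem IsArcCover.trace_subset {S : Set ℂ} {k : ℕ} {γ : Fin k → ℝ → ℂ} (hγ : IsArcCover S γ)
    (i : Fin k) : arcTrace (γ i) ⊆ S :=
  hγ.union ▸ subset_iUnion (fun i => arcTrace (γ i)) i

theorem IsArcCover.exists_frequently_mem {S : Set ℂ} {k : ℕ} {γ : Fin k → ℝ → ℂ}
    (hγ : IsArcCover S γ) {α : Type*} {F : Filter α} [F.NeBot] {c : α → ℂ}
    (hc : ∀ᶠ a in F, c a ∈ S) : ∃ i, ∃ᶠ a in F, c a ∈ arcTrace (γ i) := by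
  by_contra! h
  obtain ⟨a, ha, hnot⟩ := (hc.and (eventually_all.2 h)).exists
  rw [← hγ.union] at ha
  obtain ⟨i, hi⟩ := mem_iUnion.1 ha
  exact hnot i hi

theorem even_rootMultiplicity_of_interior (hT : 0 < T.natDegree) {t : ℝ}
    (hγ : DifferentiableAt ℝ γ t) (h0 : deriv γ t ≠ 0) (hS : ∀ᶠ s in 𝓝 t, γ s ∈ inverseImage T)
    (hroot : (T ^ 2 - 1).IsRoot (γ t)) : Even ((T ^ 2 - 1).rootMultiplicity (γ t)) := by
  obtain ⟨φ, ψ, hN⟩ := exists_isNormalForm hT (γ t)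
  have hcone : ∀ ε : ℝ, ε * deriv γ t / deriv ψ 0 ∈ directionCone T (γ t) := fun ε => by
    have hline : HasDerivAt (fun s => t + ε * s) ε 0 := by
      simpa using ((hasDerivAt_id' (0 : ℝ)).const_mul ε).const_add t
    have hd := hγ.hasDerivAt.scomp_of_eq 0 hline (by simp)
    have hlim : Tendsto (fun s => t + ε * s) (𝓝[>] 0) (𝓝 t) :=
      (Continuous.tendsto' (by fun_prop) 0 t (by simp)).mono_left nhdsWithin_le_nhds
    rw [Complex.real_smul] at hd
    exact hN.div_deriv_mem_directionCone hT hS.self_of_nhds hd.hasDerivWithinAt (by simp)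
      (hlim.eventually hS).frequently
  rw [rootMultiplicity_sq_sub_one hT hroot]
  refine even_localDegree_of_neg_mem_directionCone hroot (div_ne_zero h0 hN.deriv_symm_ne)
    ?_ ?_
  · simpa using hcone 1
  · simpa [neg_div] using hcone (-1)

theorem IsAnalyticArcParam.even_rootMultiplicity (hγ : IsAnalyticArcParam γ) (hT : 0 < T.natDegree)
    (hS : arcTrace γ ⊆ inverseImage T) {t : ℝ} (ht : t ∈ Ioo (0 : ℝ) 1)
    (hroot : (T ^ 2 - 1).IsRoot (γ t)) : Even ((T ^ 2 - 1).rootMultiplicity (γ t)) := by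
  have ht' := Ioo_subset_Icc_self ht
  refine even_rootMultiplicity_of_interior hT (hγ.analytic t ht').differentiableAt
    (hγ.regular t ht') ?_ hroot
  filter_upwards [Icc_mem_nhds ht.1 ht.2] with s hs
  exact hS (mem_image_of_mem γ hs)

end Ends

section Counting

variable {T : Polynomial ℂ} {z₀ : ℂ} {k : ℕ} {γ : Fin k → ℝ → ℂ}

/-- The ends at `z` of the arcs `γ i`: the pairs `(i, e)` for which the `i`-th arc, traversed
as in `fromEnd`, starts at `z`. -/
noncomputable def endsAt (γ : Fin k → ℝ → ℂ) (z : ℂ) : Finset (Fin k × Bool) :=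
  Finset.univ.filter fun p => fromEnd (γ p.1) p.2 0 = z

theorem mem_endsAt {p : Fin k × Bool} : p ∈ endsAt γ z₀ ↔ fromEnd (γ p.1) p.2 0 = z₀ := by
  simp [endsAt]

theorem card_filter_prod_bool {α : Type*} [Fintype α] (p : α × Bool → Prop) [DecidablePred p] :
    (Finset.univ.filter p).card =
      (Finset.univ.filter fun a => p (a, false)).card +
        (Finset.univ.filter fun a => p (a, true)).card := by
  simp only [Finset.card_filter, Fintype.sum_prod_type, Fintype.sum_bool, Finset.sum_add_distrib]
  exact add_comm _ _

theorem count_arcEndpoints (γ : Fin k → ℝ → ℂ) (z : ℂ) :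
    (arcEndpoints γ).count z = (endsAt γ z).card := by
  rw [arcEndpoints, Multiset.count_add, Multiset.count_map, Multiset.count_map, endsAt,
    card_filter_prod_bool]
  simp only [Finset.card_def, Finset.filter_val, fromEnd, cond_true, cond_false, sub_zero,
    eq_comm (a := z)]
  rfl

theorem card_arcEndpoints (γ : Fin k → ℝ → ℂ) : (arcEndpoints γ).card = 2 * k := by
  simp [arcEndpoints, two_mul]

theorem count_oddZeros (Q : Polynomial ℂ) (z : ℂ) :
    (oddZeros Q).count z = if Odd (Q.rootMultiplicity z) then Q.rootMultiplicity z else 0 := by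
  rw [oddZeros, Multiset.count_filter, Polynomial.count_roots]

theorem isRoot_of_odd_rootMultiplicity {Q : Polynomial ℂ} (h : Odd (Q.rootMultiplicity z₀)) :
    Q.IsRoot z₀ :=
  (Polynomial.rootMultiplicity_pos'.1 h.pos).2

theorem mem_inverseImage_of_isRoot (h : (T ^ 2 - 1).IsRoot z₀) : z₀ ∈ inverseImage T := by
  rcases isRoot_sq_sub_one_iff.1 h with h | h
  · exact ⟨1, by simp, by simp [h]⟩
  · exact ⟨-1, by simp, by simp [h]⟩

theorem IsArcCover.unitDirections_subset (hγ : IsArcCover (inverseImage T) γ)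
    (hT : 0 < T.natDegree) {φ ψ : ℂ → ℂ} (hN : IsNormalForm T z₀ φ ψ)
    (hodd : Odd ((T ^ 2 - 1).rootMultiplicity z₀)) :
    unitDirections T z₀ ⊆
      (fun p : Fin k × Bool => outDirection (deriv ψ 0) (fromEnd (γ p.1) p.2)) '' endsAt γ z₀ := by
  rintro ω ⟨hω, hω1⟩
  have hroot := isRoot_of_odd_rootMultiplicity hodd
  have hω0 : ω ≠ 0 := norm_ne_zero_iff.1 (hω1.out ▸ one_ne_zero)
  obtain ⟨i, hi⟩ := hγ.exists_frequently_mem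
    (hN.eventually_symm_mul_mem hT (mem_inverseImage_of_isRoot hroot) hω)
  have hbase : ψ ((0 : ℝ) * ω) = z₀ := by simp [hN.symm_apply_zero]
  obtain ⟨e, he, ρ, hρ, hd⟩ := (hγ.arc i).exists_fromEnd_of_tangent
    (mul_ne_zero hN.deriv_symm_ne hω0) (hN.hasDerivAt_symm_mul ω).hasDerivWithinAt hi
    fun t ht hz => by
      rw [hbase] at hz
      exact Nat.not_even_iff_odd.2 hodd
        (hz ▸ (hγ.arc i).even_rootMultiplicity hT (hγ.trace_subset i) ht (hz ▸ hroot))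
  exact ⟨(i, e), mem_endsAt.2 (he.trans hbase), outDirection_eq_of_pos hN.deriv_symm_ne hω1 hρ hd⟩

theorem IsArcCover.oddZeros_le (hγ : IsArcCover (inverseImage T) γ) (hT : 0 < T.natDegree) :
    oddZeros (T ^ 2 - 1) ≤ arcEndpoints γ := by
  refine Multiset.le_iff_count.2 fun z₀ => ?_
  rw [count_oddZeros, count_arcEndpoints]
  split_ifs with hodd
  · obtain ⟨φ, ψ, hN⟩ := exists_isNormalForm hT z₀
    have hroot := isRoot_of_odd_rootMultiplicity hodd
    rw [rootMultiplicity_sq_sub_one hT hroot, ← ncard_unitDirections hT hroot,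
      ← ncard_coe_finset (endsAt γ z₀)]
    exact (ncard_le_ncard (hγ.unitDirections_subset hT hN hodd)).trans
      (ncard_image_le (Finset.finite_toSet _))
  · exact Nat.zero_le _

/-- No two of the arcs have a common point with parallel tangents. -/
def NoParallelContact (γ : Fin k → ℝ → ℂ) : Prop :=
  ∀ i j, i ≠ j → ∀ s ∈ Icc (0 : ℝ) 1, ∀ t ∈ Icc (0 : ℝ) 1, γ i s = γ j t →
    ∀ ρ : ℝ, deriv (γ j) t ≠ ρ * deriv (γ i) s

theorem NoParallelContact.finite_inter (hP : NoParallelContact γ)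
    (hγ : ∀ i, IsAnalyticArcParam (γ i)) {i j : Fin k} (hij : i ≠ j) :
    (arcTrace (γ i) ∩ arcTrace (γ j)).Finite := by
  by_contra hinf
  obtain ⟨s, hs, t, ht, hst, ρ, hρ⟩ := exists_parallel_of_infinite_inter (hγ i) (hγ j) hinf
  exact hP i j hij s hs t ht hst ρ hρ

theorem exists_fromEnd_zero_eq {η : ℝ → ℂ} (hη : IsAnalyticArcParam η) (e : Bool) :
    ∃ s ∈ Icc (0 : ℝ) 1, η s = fromEnd η e 0 ∧ ∃ ε : ℝ, deriv (fromEnd η e) 0 = ε * deriv η s := by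
  cases e with
  | false => exact ⟨0, by simp, rfl, 1, by simp [fromEnd]⟩
  | true =>
    have hd := hasDerivAt_fromEnd_true (hη.analytic 1 (by simp)).differentiableAt
    rw [sub_self] at hd
    exact ⟨1, by simp, by simp [fromEnd], -1, by simp [hd.deriv]⟩

theorem NoParallelContact.deriv_fromEnd_ne (hP : NoParallelContact γ)
    (hγ : ∀ i, IsAnalyticArcParam (γ i)) {i j : Fin k} (hij : i ≠ j) {e : Bool} {t : ℝ}
    (ht : t ∈ Icc (0 : ℝ) 1) (h : fromEnd (γ i) e 0 = γ j t) (ρ : ℝ) :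
    deriv (fromEnd (γ i) e) 0 ≠ ρ * deriv (γ j) t := by
  intro hρ
  obtain ⟨s, hs, hse, ε, hε⟩ := exists_fromEnd_zero_eq (hγ i) e
  have hd := hε.symm.trans hρ
  have hne : (ρ : ℂ) * deriv (γ j) t ≠ 0 :=
    hρ ▸ (isAnalyticArcParam_fromEnd (hγ i) e).regular 0 (left_mem_Icc.2 zero_le_one)
  refine hP i j hij s hs t ht (hse.trans h) (ρ⁻¹ * ε) ?_
  rw [Complex.ofReal_mul, Complex.ofReal_inv, mul_assoc, hd,
    inv_mul_cancel_left₀ (left_ne_zero_of_mul hne)]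

theorem IsArcCover.neg_outDirection_notMem (hγ : IsArcCover (inverseImage T) γ)
    (hT : 0 < T.natDegree) (hP : NoParallelContact γ) {φ ψ : ℂ → ℂ} (hN : IsNormalForm T z₀ φ ψ)
    (hz₀ : z₀ ∈ inverseImage T) {i : Fin k} {e : Bool} (hi : (i, e) ∈ endsAt γ z₀) :
    -outDirection (deriv ψ 0) (fromEnd (γ i) e) ∉ directionCone T z₀ := by
  intro hmem
  set η := fromEnd (γ i) e
  set d := outDirection (deriv ψ 0) η
  have hη : IsAnalyticArcParam η := isAnalyticArcParam_fromEnd (hγ.arc i) e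
  have hη0 : η 0 = z₀ := mem_endsAt.1 hi
  have hηS : arcTrace η ⊆ inverseImage T := arcTrace_fromEnd (γ i) e ▸ hγ.trace_subset i
  have hd1 : ‖d‖ = 1 := (hη.outDirection_mem_unitDirections hN hT hηS hη0).2
  have hd0 : -d ≠ 0 := neg_ne_zero.2 (norm_ne_zero_iff.1 (hd1 ▸ one_ne_zero))
  have hκd : deriv ψ 0 * -d ≠ 0 := mul_ne_zero hN.deriv_symm_ne hd0
  have hc := (hN.hasDerivAt_symm_mul (-d)).hasDerivWithinAt (s := Ioi 0)
  have hbase : ψ ((0 : ℝ) * -d) = z₀ := by simp [hN.symm_apply_zero]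
  obtain ⟨j, hj⟩ := hγ.exists_frequently_mem (hN.eventually_symm_mul_mem hT hz₀ hmem)
  rcases eq_or_ne i j with rfl | hij
  · rw [← arcTrace_fromEnd (γ i) e] at hj
    obtain ⟨t, ht, htc, ρ, hρ, hρ0, -⟩ := hη.exists_tangent hκd hc hj
    have h0 : t = 0 :=
      hη.injective ht (left_mem_Icc.2 zero_le_one) (htc.trans (hbase.trans hη0.symm))
    have hd := outDirection_eq_of_pos hN.deriv_symm_ne (norm_neg d ▸ hd1) (hρ0 h0) (h0 ▸ hρ)
    exact hd0 (neg_eq_zero.2 (self_eq_neg.1 hd))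
  · obtain ⟨t, ht, htc, ρ, hρ, -, -⟩ := (hγ.arc j).exists_tangent hκd hc hj
    refine hP.deriv_fromEnd_ne hγ.arc hij ht (hη0.trans (htc.trans hbase).symm)
      (-(‖deriv η 0 / deriv ψ 0‖ * ρ)) ?_
    rw [Complex.ofReal_neg, Complex.ofReal_mul, neg_mul, mul_assoc, ← hρ, mul_neg, mul_neg, neg_neg,
      norm_mul_mul_outDirection hN.deriv_symm_ne]

theorem NoParallelContact.injOn_outDirection (hP : NoParallelContact γ)
    (hγ : ∀ i, IsAnalyticArcParam (γ i)) {κ : ℂ} (hκ : κ ≠ 0) :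
    InjOn (fun p : Fin k × Bool => outDirection κ (fromEnd (γ p.1) p.2)) (endsAt γ z₀) := by
  rintro ⟨i, e⟩ hi ⟨j, e'⟩ hj h
  have hi0 := mem_endsAt.1 hi
  have hj0 := mem_endsAt.1 hj
  obtain rfl : i = j := by
    by_contra hij
    obtain ⟨ρ, hρ⟩ := exists_deriv_eq_mul_of_outDirection_eq hκ h.symm
    obtain ⟨t, ht, hte, ε, hε⟩ := exists_fromEnd_zero_eq (hγ j) e'
    refine hP.deriv_fromEnd_ne hγ hij ht (hi0.trans (hte.trans hj0).symm) (ρ * ε) ?_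
    rw [hρ, hε, Complex.ofReal_mul, mul_assoc]
  have h01 : γ i 0 ≠ γ i 1 := fun h => zero_ne_one
    ((hγ i).injective (left_mem_Icc.2 zero_le_one) (right_mem_Icc.2 zero_le_one) h)
  have hends : fromEnd (γ i) e 0 = fromEnd (γ i) e' 0 := hi0.trans hj0.symm
  cases e <;> cases e' <;> simp_all [fromEnd, eq_comm]

theorem IsArcCover.arcEndpoints_le (hγ : IsArcCover (inverseImage T) γ) (hT : 0 < T.natDegree)
    (hP : NoParallelContact γ) : arcEndpoints γ ≤ oddZeros (T ^ 2 - 1) := by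
  refine Multiset.le_iff_count.2 fun z₀ => ?_
  rw [count_arcEndpoints]
  rcases (endsAt γ z₀).eq_empty_or_nonempty with hempty | ⟨⟨i, e⟩, hi⟩
  · simp [hempty]
  obtain ⟨φ, ψ, hN⟩ := exists_isNormalForm hT z₀
  have hmaps : ∀ p ∈ endsAt γ z₀,
      outDirection (deriv ψ 0) (fromEnd (γ p.1) p.2) ∈ unitDirections T z₀ := fun p hp =>
    (isAnalyticArcParam_fromEnd (hγ.arc p.1) p.2).outDirection_mem_unitDirections hN hT
      (arcTrace_fromEnd (γ p.1) p.2 ▸ hγ.trace_subset p.1) (mem_endsAt.1 hp)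
  have hz₀ : z₀ ∈ inverseImage T := by
    obtain ⟨s, hs, hse, -⟩ := exists_fromEnd_zero_eq (hγ.arc i) e
    exact hse.trans (mem_endsAt.1 hi) ▸ hγ.trace_subset i (mem_image_of_mem _ hs)
  obtain ⟨hroot, hodd⟩ : (T ^ 2 - 1).IsRoot z₀ ∧ ¬ Even (localDegree T z₀) := by
    by_contra! h
    exact hγ.neg_outDirection_notMem hT hP hN hz₀ hi
      (neg_mem_directionCone (fun hr => h hr) (hmaps _ hi).1)
  have hmult := rootMultiplicity_sq_sub_one hT hroot
  rw [count_oddZeros, if_pos (hmult ▸ Nat.not_even_iff_odd.1 hodd), hmult,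
    ← ncard_unitDirections hT hroot, ← ncard_coe_finset]
  exact ncard_le_ncard_of_injOn _ hmaps (hP.injOn_outDirection hγ.arc hN.deriv_symm_ne)
    (finite_unitDirections hT z₀)

end Counting

section Existence

variable {T : Polynomial ℂ} {z₀ : ℂ} {φ ψ : ℂ → ℂ}

theorem isCompact_inverseImage (hT : 0 < T.natDegree) : IsCompact (inverseImage T) := by
  have hpre : inverseImage T = (fun z => T.eval z) ⁻¹' ((↑) '' Icc (-1 : ℝ) 1) := by
    ext z
    simp only [inverseImage, mem_preimage, mem_image, mem_ofPred_eq, eq_comm]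
  have hclosed : IsClosed (inverseImage T) :=
    hpre ▸ (isCompact_Icc.image Complex.continuous_ofReal).isClosed.preimage T.continuous
  have hgrowth := T.tendsto_norm_atTop (Polynomial.natDegree_pos_iff_degree_pos.1 hT)
    (tendsto_norm_cocompact_atTop (E := ℂ))
  obtain ⟨K, hK, hKs⟩ := mem_cocompact.1 (hgrowth.eventually (eventually_gt_atTop 1))
  refine hK.of_isClosed_subset hclosed fun z ⟨x, hx, hTx⟩ => ?_
  by_contra hzK
  have hlarge : 1 < ‖T.eval z‖ := hKs hzK
  rw [hTx, Complex.norm_real, Real.norm_eq_abs] at hlarge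
  exact hlarge.not_ge (abs_le.2 hx)

theorem unitDirections_nonempty (hT : 0 < T.natDegree) (z₀ : ℂ) :
    (unitDirections T z₀).Nonempty := by
  have hm := localDegree_pos hT z₀
  obtain ⟨y, hy, h1, h2⟩ : ∃ y : ℝ, y ^ 2 = 1 ∧ (T.eval z₀ = 1 → y ≤ 0) ∧
      (T.eval z₀ = -1 → 0 ≤ y) := by
    by_cases h : T.eval z₀ = 1
    · refine ⟨-1, by norm_num, by norm_num, fun h' => ?_⟩
      norm_num [h] at h'
    · exact ⟨1, by norm_num, fun h' => (h h').elim, by norm_num⟩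
  obtain ⟨ω, hω⟩ := IsAlgClosed.exists_pow_nat_eq (y : ℂ) hm
  refine ⟨ω, ⟨y, hω, h1, h2⟩, Complex.norm_eq_one_of_pow_eq_one (n := localDegree T z₀ * 2) ?_ ?_⟩
  · rw [pow_mul, hω]
    exact_mod_cast hy
  · omega

theorem exists_norm_mul_eq_of_mem_directionCone (hT : 0 < T.natDegree) {w : ℂ}
    (hw : w ∈ directionCone T z₀) : ∃ ω ∈ unitDirections T z₀, ‖w‖ * ω = w := by
  rcases eq_or_ne w 0 with rfl | hw0
  · obtain ⟨ω, hω⟩ := unitDirections_nonempty hT z₀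
    exact ⟨ω, hω, by simp⟩
  · refine ⟨(‖w‖⁻¹ : ℝ) * w, ⟨ofReal_mul_mem_directionCone hw (by positivity), ?_⟩, ?_⟩
    · simp [hw0]
    · rw [Complex.ofReal_inv, mul_inv_cancel_left₀ (by simpa using hw0)]

theorem isAnalyticArcParam_comp_ofReal_mul {U : Set ℂ} {w : ℂ} (hw : w ≠ 0)
    (hU : ∀ s ∈ Icc (0 : ℝ) 1, s * w ∈ U) (hψ : AnalyticOnNhd ℂ ψ U) (hinj : InjOn ψ U)
    (hderiv : ∀ z ∈ U, deriv ψ z ≠ 0) : IsAnalyticArcParam fun s : ℝ => ψ (s * w) where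
  analytic s hs := (hψ _ (hU s hs)).restrictScalars.fun_comp
    (f := fun s : ℝ => (s : ℂ) * w) ((Complex.ofRealCLM.analyticAt s).mul analyticAt_const)
  injective s hs t ht hst := by
    exact_mod_cast mul_right_cancel₀ hw (hinj (hU s hs) (hU t ht) hst)
  regular s hs := by
    have hline : HasDerivAt (fun s : ℝ => (s : ℂ) * w) w s := by
      simpa using (hasDerivAt_id' s).ofReal_comp.mul_const w
    have hd := (hψ _ (hU s hs)).differentiableAt.hasDerivAt.comp_of_eq s hline rfl
    exact hd.deriv ▸ mul_ne_zero (hderiv _ (hU s hs)) hw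

theorem IsNormalForm.exists_closedBall (hN : IsNormalForm T z₀ φ ψ) (hT : 0 < T.natDegree)
    (hz₀ : z₀ ∈ inverseImage T) :
    ∃ r : ℝ, 0 < r ∧ AnalyticOnNhd ℂ ψ (Metric.closedBall 0 r) ∧
      InjOn ψ (Metric.closedBall 0 r) ∧ (∀ w ∈ Metric.closedBall 0 r, deriv ψ w ≠ 0) ∧
      ∀ w ∈ Metric.closedBall 0 r, ψ w ∈ inverseImage T ↔ w ∈ directionCone T z₀ := by
  have hlocal : ∀ᶠ w in 𝓝 (0 : ℂ), AnalyticAt ℂ ψ w ∧ φ (ψ w) = w ∧ deriv ψ w ≠ 0 ∧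
      (ψ w ∈ inverseImage T ↔ w ∈ directionCone T z₀) :=
    hN.analytic_symm.eventually_analyticAt.and <| hN.right_inv.and <|
      (hN.analytic_symm.deriv.continuousAt.eventually_ne hN.deriv_symm_ne).and <|
        hN.eventually_symm_mem_inverseImage_iff hT hz₀
  obtain ⟨r, hr, hball⟩ := Metric.nhds_basis_closedBall.eventually_iff.1 hlocal
  refine ⟨r, hr, fun w hw => (hball hw).1, ?_, fun w hw => (hball hw).2.2.1,
    fun w hw => (hball hw).2.2.2⟩
  exact LeftInvOn.injOn fun w hw => (hball hw).2.1

theorem exists_finite_arcs_mem_nhdsWithin (hT : 0 < T.natDegree) (hz₀ : z₀ ∈ inverseImage T) :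
    ∃ 𝒞 : Set (Set ℂ), 𝒞.Finite ∧ (∀ C ∈ 𝒞, IsAnalyticJordanArc C ∧ C ⊆ inverseImage T) ∧
      ⋃₀ 𝒞 ∈ 𝓝[inverseImage T] z₀ := by
  obtain ⟨φ, ψ, hN⟩ := exists_isNormalForm hT z₀
  obtain ⟨r, hr, hψ, hinj, hderiv, hiff⟩ := hN.exists_closedBall hT hz₀
  set ray : ℂ → ℝ → ℂ := fun ω s => ψ (s * (r * ω))
  have hball : ∀ ω ∈ unitDirections T z₀, ∀ s ∈ Icc (0 : ℝ) 1,
      s * (r * ω) ∈ Metric.closedBall (0 : ℂ) r := fun ω hω s hs => by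
    have hω1 : ‖ω‖ = 1 := hω.2
    simpa [hω1, abs_of_pos hr, abs_of_nonneg hs.1] using mul_le_of_le_one_left hr.le hs.2
  refine ⟨(fun ω => arcTrace (ray ω)) '' unitDirections T z₀,
    (finite_unitDirections hT z₀).image _, ?_, ?_⟩
  · rintro _ ⟨ω, hω, rfl⟩
    refine ⟨⟨ray ω, isAnalyticArcParam_comp_ofReal_mul ?_ (hball ω hω) hψ hinj hderiv, rfl⟩, ?_⟩
    · have hω0 : ω ≠ 0 := norm_ne_zero_iff.1 (hω.2.out ▸ one_ne_zero)
      exact mul_ne_zero (mod_cast hr.ne') hω0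
    · rintro _ ⟨s, hs, rfl⟩
      exact (hiff _ (hball ω hω s hs)).2
        (ofReal_mul_mem_directionCone (ofReal_mul_mem_directionCone hω.1 hr.le) hs.1)
  · filter_upwards [nhdsWithin_le_nhds (hN.tendsto (Metric.closedBall_mem_nhds 0 hr)),
      nhdsWithin_le_nhds hN.left_inv, self_mem_nhdsWithin] with z hzr hz hzS
    obtain ⟨ω, hω, hφω⟩ := exists_norm_mul_eq_of_mem_directionCone hT
      ((hiff _ hzr).1 (hz.symm ▸ hzS))
    refine ⟨_, mem_image_of_mem _ hω, ‖φ z‖ / r, ⟨by positivity, ?_⟩, ?_⟩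
    · exact (div_le_one hr).2 (mem_closedBall_zero_iff.1 hzr)
    · have hr0 : (r : ℂ) ≠ 0 := mod_cast hr.ne'
      simp only [ray]
      rw [Complex.ofReal_div, ← mul_assoc, div_mul_cancel₀ _ hr0, hφω, hz]

theorem exists_isArcCover_of_finite {𝒞 : Set (Set ℂ)} (hf : 𝒞.Finite)
    (harc : ∀ C ∈ 𝒞, IsAnalyticJordanArc C) :
    ∃ γ : Fin 𝒞.ncard → ℝ → ℂ, IsArcCover (⋃₀ 𝒞) γ := by
  have := hf.to_subtype
  let e : 𝒞 ≃ Fin 𝒞.ncard := Finite.equivFin 𝒞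
  choose γ hγ htr using fun i => harc (e.symm i) (e.symm i).2
  refine ⟨γ, hγ, ?_⟩
  simp only [htr, sUnion_eq_iUnion]
  exact e.symm.surjective.iUnion_comp fun C => (C : Set ℂ)

theorem exists_isArcCover (hT : 0 < T.natDegree) :
    ∃ k, ∃ γ : Fin k → ℝ → ℂ, IsArcCover (inverseImage T) γ := by
  obtain ⟨𝒞, hf, harc, hcover⟩ : ∃ 𝒞 : Set (Set ℂ), 𝒞.Finite ∧
      (∀ C ∈ 𝒞, IsAnalyticJordanArc C ∧ C ⊆ inverseImage T) ∧ inverseImage T ⊆ ⋃₀ 𝒞 := by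
    refine (isCompact_inverseImage hT).induction_on
      (p := fun A => ∃ 𝒞 : Set (Set ℂ), 𝒞.Finite ∧
        (∀ C ∈ 𝒞, IsAnalyticJordanArc C ∧ C ⊆ inverseImage T) ∧ A ⊆ ⋃₀ 𝒞)
      ⟨∅, by simp⟩ (fun A B hAB ⟨𝒞, hf, h, hB⟩ => ⟨𝒞, hf, h, hAB.trans hB⟩) ?_ fun z hz => ?_
    · rintro A B ⟨𝒞, hf, h, hA⟩ ⟨𝒟, hf', h', hB⟩
      exact ⟨𝒞 ∪ 𝒟, hf.union hf', fun C hC => hC.elim (h C) (h' C),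
        sUnion_union 𝒞 𝒟 ▸ union_subset_union hA hB⟩
    · obtain ⟨𝒞, hf, h, hz⟩ := exists_finite_arcs_mem_nhdsWithin hT hz
      exact ⟨_, hz, 𝒞, hf, h, Subset.rfl⟩
  obtain ⟨γ, hγ⟩ := exists_isArcCover_of_finite hf fun C hC => (harc C hC).1
  exact ⟨_, γ, Subset.antisymm (sUnion_subset fun C hC => (harc C hC).2) hcover ▸ hγ⟩

end Existence

section Decomposition

variable {S : Set ℂ} {T : Polynomial ℂ} {k : ℕ} {γ : Fin k → ℝ → ℂ}

theorem IsArcCover.exists_lt_isArcCover (hγ : IsArcCover S γ) {i j : Fin k} (hij : i ≠ j)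
    (h : IsAnalyticJordanArc (arcTrace (γ i) ∪ arcTrace (γ j))) :
    ∃ l < k, ∃ η : Fin l → ℝ → ℂ, IsArcCover S η := by
  set A : Fin k → Set ℂ := fun l => arcTrace (γ l)
  set 𝒞 : Set (Set ℂ) := insert (A i ∪ A j) (A '' {i, j}ᶜ)
  have harc : ∀ C ∈ 𝒞, IsAnalyticJordanArc C := by
    rintro C (rfl | ⟨l, -, rfl⟩)
    exacts [h, ⟨γ l, hγ.arc l, rfl⟩]
  have hunion : ⋃₀ 𝒞 = S := by
    rw [sUnion_insert, sUnion_image, ← biUnion_pair, ← biUnion_union, union_compl_self,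
      biUnion_univ, hγ.union]
  have hcard : 𝒞.ncard < k :=
    calc 𝒞.ncard ≤ (A '' {i, j}ᶜ).ncard + 1 := ncard_insert_le _ _
      _ ≤ ({i, j}ᶜ : Set (Fin k)).ncard + 1 := Nat.succ_le_succ (ncard_image_le (toFinite _))
      _ < ({i, j} : Set (Fin k)).ncard + ({i, j}ᶜ : Set (Fin k)).ncard := by
        rw [ncard_pair hij]; omega
      _ = k := by rw [ncard_add_ncard_compl, Nat.card_fin]
  obtain ⟨η, hη⟩ := exists_isArcCover_of_finite ((toFinite _).insert _) harc
  exact ⟨_, hcard, η, hunion ▸ hη⟩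

theorem im_eval_of_mem_inverseImage {z : ℂ} (hz : z ∈ inverseImage T) : (T.eval z).im = 0 := by
  obtain ⟨x, -, hx⟩ := hz
  rw [hx, Complex.ofReal_im]

theorem IsArcCover.noParallelContact (hT : 0 < T.natDegree) (hγ : IsArcCover (inverseImage T) γ)
    (hmin : ∀ l < k, ¬ ∃ η : Fin l → ℝ → ℂ, IsArcCover (inverseImage T) η) :
    NoParallelContact γ := by
  intro i j hij s hs t ht hst ρ hρ
  obtain ⟨l, hl, hη⟩ := hγ.exists_lt_isArcCover hij <|
    isAnalyticJordanArc_union hT (hγ.arc i) (hγ.arc j)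
      (fun z hz => im_eval_of_mem_inverseImage
        (union_subset (hγ.trace_subset i) (hγ.trace_subset j) hz)) hs ht hst hρ
  exact hmin l hl hη

theorem exists_isArcDecomposition (hT : 0 < T.natDegree) :
    ∃ k, ∃ γ : Fin k → ℝ → ℂ, IsArcDecomposition (inverseImage T) γ ∧
      arcEndpoints γ = oddZeros (T ^ 2 - 1) := by
  classical
  have hcover := exists_isArcCover hT
  obtain ⟨γ, hγ⟩ := Nat.find_spec hcover
  have hP := hγ.noParallelContact hT fun l hl => Nat.find_min hcover hl
  exact ⟨_, γ, ⟨hγ, fun i j hij => hP.finite_inter hγ.arc hij⟩,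
    le_antisymm (hγ.arcEndpoints_le hT hP) (hγ.oddZeros_le hT)⟩

theorem IsArcCover.card_oddZeros_le (hγ : IsArcCover (inverseImage T) γ) (hT : 0 < T.natDegree) :
    (oddZeros (T ^ 2 - 1)).card ≤ 2 * k :=
  card_arcEndpoints γ ▸ Multiset.card_le_card (hγ.oddZeros_le hT)

theorem isArcDecomposition_minimal_iff (hT : 0 < T.natDegree) (k : ℕ) (B : Multiset ℂ)
    (hB : B.card = 2 * k) :
    ((∃ γ : Fin k → ℝ → ℂ, IsArcDecomposition (inverseImage T) γ ∧ arcEndpoints γ = B) ∧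
      ∀ l < k, ¬ ∃ γ : Fin l → ℝ → ℂ, IsArcDecomposition (inverseImage T) γ) ↔
    oddZeros (T ^ 2 - 1) = B := by
  obtain ⟨κ, η, hη, hends⟩ := exists_isArcDecomposition hT
  have hcard : (oddZeros (T ^ 2 - 1)).card = 2 * κ := hends ▸ card_arcEndpoints η
  constructor
  · rintro ⟨⟨γ, hγ, rfl⟩, hmin⟩
    have hk : k ≤ κ := not_lt.1 fun h => hmin κ h ⟨η, hη⟩
    exact Multiset.eq_of_le_of_card_le (hγ.toIsArcCover.oddZeros_le hT) (by omega)
  · rintro rfl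
    obtain rfl : κ = k := by omega
    refine ⟨⟨η, hη, hends⟩, fun l hl ⟨γ, hγ⟩ => ?_⟩
    have := hγ.toIsArcCover.card_oddZeros_le hT
    omega

theorem exists_inter_eq_singleton_and_even_rootMultiplicity (hT : 0 < T.natDegree)
    {γ₁ γ₂ : ℝ → ℂ} (h₁ : IsAnalyticArcParam γ₁) (h₂ : IsAnalyticArcParam γ₂)
    (hS₁ : arcTrace γ₁ ⊆ inverseImage T) (hS₂ : arcTrace γ₂ ⊆ inverseImage T)
    (h0 : (T ^ 2 - 1).IsRoot (γ₁ 0)) (h1 : (T ^ 2 - 1).IsRoot (γ₁ 1))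
    (hfin : (arcTrace γ₁ ∩ arcTrace γ₂).Finite)
    (hu : IsAnalyticJordanArc (arcTrace γ₁ ∪ arcTrace γ₂)) :
    ∃ z₀ : ℂ, arcTrace γ₁ ∩ arcTrace γ₂ = {z₀} ∧
      (z₀ = γ₁ 0 ∨ z₀ = γ₁ 1) ∧ (z₀ = γ₂ 0 ∨ z₀ = γ₂ 1) ∧
      (T ^ 2 - 1).IsRoot z₀ ∧ Even ((T ^ 2 - 1).rootMultiplicity z₀) := by
  obtain ⟨γ, hγ, hγu⟩ := hu
  obtain ⟨s, hs, hinter, he₁, he₂⟩ := exists_inter_eq_singleton_of_union_eq hγ h₁ h₂ hfin hγu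
  have hroot : (T ^ 2 - 1).IsRoot (γ s) := he₁.elim (fun h => h ▸ h0) (fun h => h ▸ h1)
  exact ⟨γ s, hinter, he₁, he₂, hroot,
    hγ.even_rootMultiplicity hT (hγu ▸ union_subset hS₁ hS₂) hs hroot⟩

end Decomposition

theorem theorem1 (n : ℕ) (hn : 1 ≤ n) (T : Polynomial ℂ) (hT : T.natDegree = n) :
    -- the equivalence
    (∀ (ν : ℕ) (b : Fin (2 * ν) → ℂ),
      ((∃ γ : Fin ν → ℝ → ℂ, IsArcDecomposition (inverseImage T) γ ∧
          arcEndpoints γ = Finset.univ.val.map b) ∧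
        (∀ k < ν, ¬ ∃ γ : Fin k → ℝ → ℂ, IsArcDecomposition (inverseImage T) γ)) ↔
      oddZeros (T ^ 2 - 1) = Finset.univ.val.map b) ∧
    -- the minimality holds even among families of arcs that may overlap
    (∀ (k : ℕ) (γ : Fin k → ℝ → ℂ), IsArcCover (inverseImage T) γ →
      (oddZeros (T ^ 2 - 1)).card ≤ 2 * k) ∧
    -- two arcs can be merged into one only at a zero of even multiplicity
    (∀ γ₁ γ₂ : ℝ → ℂ, IsAnalyticArcParam γ₁ → IsAnalyticArcParam γ₂ →
      arcTrace γ₁ ⊆ inverseImage T → arcTrace γ₂ ⊆ inverseImage T →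
      (T ^ 2 - 1).IsRoot (γ₁ 0) → (T ^ 2 - 1).IsRoot (γ₁ 1) →
      (T ^ 2 - 1).IsRoot (γ₂ 0) → (T ^ 2 - 1).IsRoot (γ₂ 1) →
      (arcTrace γ₁ ∩ arcTrace γ₂).Finite →
      IsAnalyticJordanArc (arcTrace γ₁ ∪ arcTrace γ₂) →
      ∃ z₀ : ℂ, arcTrace γ₁ ∩ arcTrace γ₂ = {z₀} ∧
        (z₀ = γ₁ 0 ∨ z₀ = γ₁ 1) ∧ (z₀ = γ₂ 0 ∨ z₀ = γ₂ 1) ∧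
        (T ^ 2 - 1).IsRoot z₀ ∧ Even ((T ^ 2 - 1).rootMultiplicity z₀)) := by
  have hT0 : 0 < T.natDegree := hT ▸ hn
  refine ⟨fun ν b => isArcDecomposition_minimal_iff hT0 ν _ (by simp),
    fun _ _ hγ => hγ.card_oddZeros_le hT0, ?_⟩
  intro γ₁ γ₂ h₁ h₂ hS₁ hS₂ h0 h1 _ _
  exact exists_inter_eq_singleton_and_even_rootMultiplicity hT0 h₁ h₂ hS₁ hS₂ h0 h1
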